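/- Let $m\ge 0$, let $R=\mathbb C[x_1,\dots,x_m]/\mathfrak m^3$ where $\mathfrak m=(x_1,\dots,x_m)$, and regard $\mathbb C=R/(x_1,\dots,x_m)$ as an $R$-module. Let $V=\mathbb C^m$ be the standard representation of $\mathrm{GL}_m(\mathbb C)$. The group $\mathrm{GL}_m(\mathbb C)$ acts on $R$ by the $\mathbb C$-algebra automorphisms $g\cdot x_j=\sum_i g_{ij}x_i$ (so that the span of $x_1,\dots,x_m$ is $V$), and hence, by functoriality, on the complex vector spaces $\mathrm{Tor}^R_i(\mathbb C,\mathbb C)$: if $P_\bullet\to\mathbb C$ is a projective resolution over $R$ and $f\colon P_\bullet\to P_\bullet$ is a chain map lifting $\mathrm{id}_{\mathbb C}$ with $f(rp)=(g\cdot r)f(p)$, then $g$ acts on $H_i(\mathbb C\otimes_R P_\bullet)$ by $H_i(\mathrm{id}\otimes f)$. For a Coxeter group $G$ with a finite linearly ordered set $S$ of generators and a $G$-module $A$, the Coxeter cohomology $H^k_C(G,A)$ is the cohomology of the cochain complex with $X^k=\bigoplus_{T} A^{\langle T\rangle}$, the sum being over the $k$-element sets $T\subseteq S$ of pairwise commuting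 generators, whose differential has the components $d_{T,s}\colon A^{\langle T\rangle}\to A^{\langle T\cup\{s\}\rangle}$, $d_{T,s}(v)=(-1)^{|\{t\in T\,:\,t<s\}|}(v+s(v))$, for $s\notin T$ with $T\cup\{s\}$ pairwise commuting. Write $\mathsf A_{n-1}$ for the symmetric group $S_n$ ($n\ge1$) with generators the adjacent transpositions $s_k=(k\ k{+}1)$, $1\le k\le n-1$, in their natural order; it acts on $V^{\otimes n}$ by permuting the tensor factors. This action commutes with the diagonal action of $\mathrm{GL}_m(\mathbb C)$, which therefore acts on $H^k_C(\mathsf A_{n-1},V^{\otimes n})$. Then for every $i\ge 1$ there is an isomorphism $$\mathrm{Tor}_i^{R}(\mathbb C,\mathbb C)\;\cong\;\bigoplus_{0\le j\le i} H^j_C\bigl(\mathsf A_{i+j-1},V^{\otimes(i+j)}\bigr)$$ of representations of $\mathrm{GL}_m(\mathbb C)$. -/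

import Mathlib

noncomputable section

open CategoryTheory MonoidalCategory

namespace AugTor

universe u
variable {K R : Type u} [Field K] [CommRing R] [Algebra K R]

/-- The field `K`, regarded as an `R`-module through an augmentation `ε : R → K`. -/
abbrev residue (ε : R →ₐ[K] K) : ModuleCat.{u} R :=
  (ModuleCat.restrictScalars ε.toRingHom).obj (ModuleCat.of K K)

/-- The `R`-module `Tor_i^R(K, K)`. -/
abbrev torObj (ε : R →ₐ[K] K) (i : ℕ) : ModuleCat.{u} R :=
  ((Tor (ModuleCat.{u} R) i).obj (residue ε)).obj (residue ε)

/-- Restriction of scalars from `R` to the ground field. -/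
abbrev scalars (K R : Type u) [Field K] [CommRing R] [Algebra K R] :
    ModuleCat.{u} R ⥤ ModuleCat.{u} K :=
  ModuleCat.restrictScalars (algebraMap K R)

/-- `Tor_i^R(K, K)` as a vector space over `K`. -/
abbrev torSpace (ε : R →ₐ[K] K) (i : ℕ) : ModuleCat.{u} K :=
  (scalars K R).obj (torObj ε i)

/-- The functor `M ↦ K ⊗_R M`. -/
abbrev residueTensor (ε : R →ₐ[K] K) : ModuleCat.{u} R ⥤ ModuleCat.{u} R :=
  (tensoringLeft (ModuleCat.{u} R)).obj (residue ε)

/-- The complex of `K`-vector spaces `K ⊗_R P` for a projective resolution `P` of `K` over `R`. -/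
abbrev tensorComplex (ε : R →ₐ[K] K) (P : ProjectiveResolution (residue ε)) :
    ChainComplex (ModuleCat.{u} K) ℕ :=
  ((residueTensor ε ⋙ scalars K R).mapHomologicalComplex _).obj P.complex

/-- The isomorphism between `Tor_i^R(K, K)` and the `i`-th homology of `K ⊗_R P`. -/
def torIso (ε : R →ₐ[K] K) (P : ProjectiveResolution (residue ε)) (i : ℕ) :
    torSpace ε i ≅ (tensorComplex ε P).homology i :=
  (scalars K R).mapIso (P.isoLeftDerivedObj (residueTensor ε) i) ≪≫
    (((((residueTensor ε).mapHomologicalComplex _).obj P.complex).sc i).mapHomologyIso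
      (scalars K R)).symm

/-- A lift of the identity of `K` to a `σ`-semilinear endomorphism of a projective resolution
of `K` over `R`, where `σ` is an automorphism of `R`. -/
structure SemilinearLift (ε : R →ₐ[K] K) (P : ProjectiveResolution (residue ε))
    (σ : R ≃ₐ[K] R) where
  map : ∀ n, P.complex.X n →ₛₗ[(σ : R →+* R)] P.complex.X n
  comm : ∀ n x, map n ((P.complex.d (n + 1) n).hom x) = (P.complex.d (n + 1) n).hom (map (n + 1) x)
  aug : ∀ x, (P.π.f 0).hom (map 0 x) = (P.π.f 0).hom x

/-- The identity of `K` as a semilinear map of `R`-modules. -/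
def residueSemilinear (ε : R →ₐ[K] K) (σ : R ≃ₐ[K] R) (h : ∀ r, ε (σ r) = ε r) :
    residue ε →ₛₗ[(σ : R →+* R)] residue ε where
  toFun a := a
  map_add' _ _ := rfl
  map_smul' r (a : K) := by
    change ε r * a = ε (σ r) * a
    rw [h]

/-- The `K`-linear map `id ⊗ f : K ⊗_R M → K ⊗_R N` for a semilinear map `f : M → N`. -/
def tensorMap (ε : R →ₐ[K] K) (σ : R ≃ₐ[K] R) (h : ∀ r, ε (σ r) = ε r)
    {M N : ModuleCat.{u} R} (f : M →ₛₗ[(σ : R →+* R)] N) :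
    (residueTensor ε ⋙ scalars K R).obj M ⟶ (residueTensor ε ⋙ scalars K R).obj N :=
  ModuleCat.ofHom (X := (residueTensor ε ⋙ scalars K R).obj M)
    (Y := (residueTensor ε ⋙ scalars K R).obj N)
    { toFun := TensorProduct.map (residueSemilinear ε σ h) f
      map_add' := map_add (TensorProduct.map (residueSemilinear ε σ h) f)
      map_smul' := fun c x => by
        refine ((TensorProduct.map (residueSemilinear ε σ h) f).map_smulₛₗ
          (algebraMap K R c) x).trans ?_
        rw [show (σ : R →+* R) (algebraMap K R c) = algebraMap K R c from σ.commutes c]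
        rfl }


lemma tensor_hom_ext {ε : R →ₐ[K] K} {M : ModuleCat.{u} R} {Z : ModuleCat.{u} K}
    {f g : (residueTensor ε ⋙ scalars K R).obj M ⟶ Z}
    (w : ∀ (c : residue ε) (y : M), f.hom (TensorProduct.tmul R c y : TensorProduct R _ _) =
      g.hom (TensorProduct.tmul R c y : TensorProduct R _ _)) : f = g := by
  ext x
  change TensorProduct R (residue ε) M at x
  induction x using TensorProduct.induction_on with
  | zero => exact (map_zero f.hom).trans (map_zero g.hom).symm
  | add x y hx hy =>
    exact ((map_add f.hom x y).trans (congrArg₂ _ hx hy)).trans (map_add g.hom x y).symm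
  | tmul c y => exact w c y

lemma tensorMap_comp (ε : R →ₐ[K] K) (σ : R ≃ₐ[K] R) (h : ∀ r, ε (σ r) = ε r)
    {M N M' N' : ModuleCat.{u} R} (f : M →ₛₗ[(σ : R →+* R)] N) (f' : M' →ₛₗ[(σ : R →+* R)] N')
    (a : M ⟶ M') (b : N ⟶ N') (w : ∀ x, f' (a.hom x) = b.hom (f x)) :
    tensorMap ε σ h f ≫ (residueTensor ε ⋙ scalars K R).map b =
      (residueTensor ε ⋙ scalars K R).map a ≫ tensorMap ε σ h f' := by
  refine tensor_hom_ext fun c y => ?_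
  change TensorProduct.tmul R c (b.hom (f y)) = TensorProduct.tmul R c (f' (a.hom y))
  rw [w]

/-- The chain map `id ⊗ f` of `K ⊗_R P` for a semilinear lift `f`. -/
def SemilinearLift.chainMap {ε : R →ₐ[K] K} {P : ProjectiveResolution (residue ε)}
    {σ : R ≃ₐ[K] R} (h : ∀ r, ε (σ r) = ε r) (f : SemilinearLift ε P σ) :
    tensorComplex ε P ⟶ tensorComplex ε P :=
  ChainComplex.ofHom (fun n => tensorMap ε σ h (f.map n)) (fun n =>
    tensorMap_comp ε σ h _ _ _ _ (f.comm n))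

/-- Twisting the action of `R` on a module by an automorphism of `R`. -/
abbrev twist (σ : R ≃ₐ[K] R) : ModuleCat.{u} R ⥤ ModuleCat.{u} R :=
  ModuleCat.restrictScalars σ.toRingEquiv.toRingHom

/-- The twist of a projective resolution of `M` is one of the twist of `M`. -/
def twistResolution {M : ModuleCat.{u} R} (σ : R ≃ₐ[K] R) (P : ProjectiveResolution M) :
    ProjectiveResolution ((twist σ).obj M) :=
  (twist σ).mapProjectiveResolution P

/-- A semilinear map `M → N` is the same as a linear map from `M` to the twist of `N`. -/
def toTwist {σ : R ≃ₐ[K] R} {M N : ModuleCat.{u} R} (f : M →ₛₗ[(σ : R →+* R)] N) :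
    M ⟶ (twist σ).obj N :=
  ModuleCat.ofHom (X := M) (Y := (twist σ).obj N)
    { toFun := fun x => f x
      map_add' := fun x y => map_add f x y
      map_smul' := fun r x => f.map_smulₛₗ r x }

/-- The semilinear map `M → N` given by a linear map from `M` to the twist of `N`. -/
def ofTwist {σ : R ≃ₐ[K] R} {M N : ModuleCat.{u} R} (f : M ⟶ (twist σ).obj N) :
    M →ₛₗ[(σ : R →+* R)] N where
  toFun := fun x => f.hom x
  map_add' := fun x y => map_add f.hom x y
  map_smul' := fun r x => f.hom.map_smul r x

/-- A semilinear lift as a chain map to the twisted resolution. -/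
def SemilinearLift.toHom {ε : R →ₐ[K] K} {P : ProjectiveResolution (residue ε)}
    {σ : R ≃ₐ[K] R} (f : SemilinearLift ε P σ) :
    P.complex ⟶ (twistResolution σ P).complex :=
  ChainComplex.ofHom (fun n => toTwist (f.map n)) (fun n => by
    ext x
    exact (f.comm n x).symm)

lemma SemilinearLift.toHom_π {ε : R →ₐ[K] K} {P : ProjectiveResolution (residue ε)}
    {σ : R ≃ₐ[K] R} (h : ∀ r, ε (σ r) = ε r) (f : SemilinearLift ε P σ) :
    f.toHom ≫ (twistResolution σ P).π = P.π ≫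
      (ChainComplex.single₀ (ModuleCat.{u} R)).map (toTwist (residueSemilinear ε σ h)) := by
  ext x
  simp [twistResolution, SemilinearLift.toHom]
  exact f.aug x

/-- A semilinear lift from a chain map to the twisted resolution. -/
def SemilinearLift.ofHom {ε : R →ₐ[K] K} {P : ProjectiveResolution (residue ε)}
    {σ : R ≃ₐ[K] R} (h : ∀ r, ε (σ r) = ε r)
    (f : P.complex ⟶ (twistResolution σ P).complex)
    (w : f ≫ (twistResolution σ P).π = P.π ≫
      (ChainComplex.single₀ (ModuleCat.{u} R)).map (toTwist (residueSemilinear ε σ h))) :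
    SemilinearLift ε P σ where
  map n := ofTwist (f.f n)
  comm n x := by
    have := ConcreteCategory.congr_hom (f.comm (n+1) n) x
    exact this.symm
  aug x := by
    have := ConcreteCategory.congr_hom (HomologicalComplex.congr_hom w 0) x
    simp [twistResolution] at this
    exact this

/-- The canonical map from the tensor product with a twist. -/
def twistTrans (ε : R →ₐ[K] K) (σ : R ≃ₐ[K] R) (h : ∀ r, ε (σ r) = ε r) :
    twist σ ⋙ (residueTensor ε ⋙ scalars K R) ⟶ residueTensor ε ⋙ scalars K R where
  app M := tensorMap ε σ h (ofTwist (𝟙 ((twist σ).obj M)))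
  naturality _ _ _ := (tensorMap_comp ε σ h _ _ _ _ (fun _ => rfl)).symm

lemma SemilinearLift.chainMap_eq {ε : R →ₐ[K] K} {P : ProjectiveResolution (residue ε)}
    {σ : R ≃ₐ[K] R} (h : ∀ r, ε (σ r) = ε r) (f : SemilinearLift ε P σ) :
    f.chainMap h = ((residueTensor ε ⋙ scalars K R).mapHomologicalComplex _).map f.toHom ≫
      (NatTrans.mapHomologicalComplex (twistTrans ε σ h) _).app P.complex := by
  ext n : 1
  exact tensor_hom_ext fun c y => rfl

lemma SemilinearLift.homologyMap_eq {ε : R →ₐ[K] K} {P : ProjectiveResolution (residue ε)}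
    {σ : R ≃ₐ[K] R} (h : ∀ r, ε (σ r) = ε r) (f f' : SemilinearLift ε P σ) (i : ℕ) :
    HomologicalComplex.homologyMap (f.chainMap h) i =
      HomologicalComplex.homologyMap (f'.chainMap h) i := by
  rw [chainMap_eq, chainMap_eq]
  refine Homotopy.homologyMap_eq (Homotopy.compRight (Functor.mapHomotopy _ ?_) _) i
  exact ProjectiveResolution.liftHomotopy _ _ _ (f.toHom_π h) (f'.toHom_π h)

lemma SemilinearLift.exists (ε : R →ₐ[K] K) (P : ProjectiveResolution (residue ε))
    (σ : R ≃ₐ[K] R) (h : ∀ r, ε (σ r) = ε r) : Nonempty (SemilinearLift ε P σ) :=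
  ⟨.ofHom h (ProjectiveResolution.lift (toTwist (residueSemilinear ε σ h)) P (twistResolution σ P))
    (ProjectiveResolution.lift_commutes _ _ _)⟩

/-- The identity. -/
def SemilinearLift.one (ε : R →ₐ[K] K) (P : ProjectiveResolution (residue ε)) :
    SemilinearLift ε P (1 : R ≃ₐ[K] R) where
  map _ := { toFun := fun x => x, map_add' := fun _ _ => rfl, map_smul' := fun _ _ => rfl }
  comm _ _ := rfl
  aug _ := rfl

/-- The composition of two semilinear lifts. -/
def SemilinearLift.mul {ε : R →ₐ[K] K} {P : ProjectiveResolution (residue ε)}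
    {σ τ : R ≃ₐ[K] R} (f : SemilinearLift ε P σ) (f' : SemilinearLift ε P τ) :
    SemilinearLift ε P (σ * τ) where
  map n :=
    { toFun := fun x => f.map n (f'.map n x)
      map_add' := fun _ _ => by simp only [map_add]
      map_smul' := fun r x => by
        rw [LinearMap.map_smulₛₗ, LinearMap.map_smulₛₗ]
        rfl }
  comm n x := by
    simp only [LinearMap.coe_mk, AddHom.coe_mk]
    rw [f'.comm, f.comm]
  aug x := (f.aug _).trans (f'.aug x)

lemma SemilinearLift.homologyMap_one {ε : R →ₐ[K] K} {P : ProjectiveResolution (residue ε)}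
    {σ : R ≃ₐ[K] R} (h : ∀ r, ε (σ r) = ε r) (f : SemilinearLift ε P σ) (hσ : σ = 1) (i : ℕ) :
    HomologicalComplex.homologyMap (f.chainMap h) i = 𝟙 _ := by
  subst hσ
  rw [f.homologyMap_eq h (.one ε P), ← HomologicalComplex.homologyMap_id]
  congr 1
  ext n : 1
  exact tensor_hom_ext fun c y => rfl

lemma SemilinearLift.homologyMap_mul {ε : R →ₐ[K] K} {P : ProjectiveResolution (residue ε)}
    {σ τ ρ : R ≃ₐ[K] R} (hσ : ∀ r, ε (σ r) = ε r) (hτ : ∀ r, ε (τ r) = ε r)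
    (hρ : ∀ r, ε (ρ r) = ε r) (f : SemilinearLift ε P σ) (f' : SemilinearLift ε P τ)
    (f'' : SemilinearLift ε P ρ) (e : ρ = σ * τ) (i : ℕ) :
    HomologicalComplex.homologyMap (f''.chainMap hρ) i =
      HomologicalComplex.homologyMap (f'.chainMap hτ) i ≫
        HomologicalComplex.homologyMap (f.chainMap hσ) i := by
  subst e
  rw [f''.homologyMap_eq hρ (f.mul f'), ← HomologicalComplex.homologyMap_comp]
  congr 1
  ext n : 1
  exact tensor_hom_ext fun c y => rfl

/-- The endomorphism of `Tor_i^R(K, K) ≅ H_i(K ⊗_R P)` induced by `id ⊗ f`, where `f` is a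
`σ`-semilinear lift of the identity of `K` to a projective resolution `P`; it does not depend on
the choice of the lift. -/
def torEnd (ε : R →ₐ[K] K) (σ : R ≃ₐ[K] R) (h : ∀ r, ε (σ r) = ε r) (i : ℕ) :
    torSpace ε i ⟶ torSpace ε i :=
  (torIso ε (projectiveResolution (residue ε)) i).hom ≫
    HomologicalComplex.homologyMap ((SemilinearLift.exists ε
      (projectiveResolution (residue ε)) σ h).some.chainMap h) i ≫
    (torIso ε (projectiveResolution (residue ε)) i).inv

/-- Let `G` act on `R` by `K`-algebra automorphisms that are compatible with the augmentation.
This is the induced representation of `G` on `Tor_i^R(K, K)`. -/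
def torRep {G : Type*} [Group G] (ε : R →ₐ[K] K) (φ : G →* (R ≃ₐ[K] R))
    (h : ∀ g r, ε (φ g r) = ε r) (i : ℕ) : Representation K G (torSpace ε i) where
  toFun g := (torEnd ε (φ g) (h g) i).hom
  map_one' := by
    rw [torEnd, SemilinearLift.homologyMap_one _ _ (map_one φ)]
    simp
    rfl
  map_mul' g g' := by
    rw [torEnd, SemilinearLift.homologyMap_mul (h g) (h g') _
      (SemilinearLift.exists ε _ (φ g) (h g)).some
      (SemilinearLift.exists ε _ (φ g') (h g')).some _ (map_mul φ g g')]
    change _ = ModuleCat.Hom.hom (torEnd ε (φ g') (h g') i ≫ torEnd ε (φ g) (h g) i)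
    simp [torEnd]

end AugTor

namespace Coxeter

universe u
variable {K A : Type u} [CommRing K] [AddCommGroup A] [Module K A]
variable {G : Type*} [Group G] {S : Type}

/-- The sets of `k` pairwise commuting generators. -/
def CommutingSet (s : S → G) (k : ℕ) : Type :=
  {T : Finset S // T.card = k ∧ ∀ a ∈ T, ∀ b ∈ T, Commute (s a) (s b)}

/-- The subspace `A^⟨T⟩` of invariants of the subgroup generated by `T`. -/
def invariants (s : S → G) (ρ : Representation K G A) (T : Finset S) : Submodule K A where
  carrier := {v | ∀ g ∈ Subgroup.closure (s '' (T : Set S)), ρ g v = v}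
  add_mem' := fun ha hb g hg => by rw [map_add, ha g hg, hb g hg]
  zero_mem' := fun g _ => map_zero _
  smul_mem' := fun c v hv g hg => by rw [map_smul, hv g hg]

lemma mem_invariants_iff (s : S → G) (ρ : Representation K G A) (T : Finset S) (v : A) :
    v ∈ invariants s ρ T ↔ ∀ t ∈ T, ρ (s t) v = v := by
  constructor
  · intro h t ht
    exact h _ (Subgroup.subset_closure ⟨t, ht, rfl⟩)
  · intro h g hg
    induction hg using Subgroup.closure_induction with
    | mem x hx => obtain ⟨t, ht, rfl⟩ := hx; exact h t ht
    | one => simp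
    | mul x y _ _ hx hy => rw [map_mul, Module.End.mul_apply, hy, hx]
    | inv x _ hx =>
      conv_lhs => rw [← hx]
      rw [← Module.End.mul_apply, ← map_mul, inv_mul_cancel, map_one, Module.End.one_apply]

variable [LinearOrder S]

/-- The set `T \ {t}`. -/
def CommutingSet.erase {s : S → G} {k : ℕ} (T : CommutingSet s (k + 1)) (t : S) (ht : t ∈ T.1) :
    CommutingSet s k :=
  ⟨T.1.erase t, by rw [Finset.card_erase_of_mem ht, T.2.1, Nat.add_sub_cancel],
    fun a ha b hb => T.2.2 a (Finset.mem_of_mem_erase ha) b (Finset.mem_of_mem_erase hb)⟩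

/-- The `k`-cochains `⨁_T A^⟨T⟩`, the sum being over the sets `T` of `k` commuting generators
(for a finite set `S` of generators, so that the sum is a product). -/
abbrev Cochain (s : S → G) (ρ : Representation K G A) (k : ℕ) : Type u :=
  (T : CommutingSet s k) → invariants s ρ T.1

/-- The value `(-1)^|{u ∈ T | u < t}| (v + t(v))` of the component `d_{T, t}` of the differential. -/
def dComponent (s : S → G) (ρ : Representation K G A) (T : Finset S) (t : S) : A →ₗ[K] A :=
  (-1 : K) ^ (T.filter (· < t)).card • (LinearMap.id + ρ (s t))

lemma dComponent_mem {s : S → G} (hs : ∀ a, s a * s a = 1) (ρ : Representation K G A) {k : ℕ}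
    (T : CommutingSet s (k + 1)) (t : S) (ht : t ∈ T.1) {v : A}
    (hv : v ∈ invariants s ρ (T.1.erase t)) :
    dComponent s ρ (T.1.erase t) t v ∈ invariants s ρ T.1 := by
  refine Submodule.smul_mem _ _ ((mem_invariants_iff _ _ _ _).2 fun a ha => ?_)
  rw [mem_invariants_iff] at hv
  simp only [LinearMap.add_apply, LinearMap.id_apply, map_add]
  rw [← Module.End.mul_apply, ← map_mul]
  by_cases h : a = t
  · subst h
    rw [hs, map_one, Module.End.one_apply, add_comm]
  · rw [(T.2.2 a ha t ht).eq, map_mul, Module.End.mul_apply,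
      hv a (Finset.mem_erase.2 ⟨h, ha⟩)]

/-- The differential, with components `d_{T, t} : A^⟨T⟩ → A^⟨T ∪ {t}⟩`. -/
def d {s : S → G} (hs : ∀ a, s a * s a = 1) (ρ : Representation K G A) (k : ℕ) :
    Cochain s ρ k →ₗ[K] Cochain s ρ (k + 1) where
  toFun f T := ∑ t : {t // t ∈ T.1},
    ⟨dComponent s ρ (T.1.erase t) t (f (T.erase t t.2)),
      dComponent_mem hs ρ T t t.2 (f (T.erase t t.2)).2⟩
  map_add' f f' := by
    ext T
    simp [Finset.sum_add_distrib]
  map_smul' c f := by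
    ext T
    simp [Finset.smul_sum]

lemma sign_swap (T : Finset S) {t u : S} (ht : t ∈ T) (h : t < u) :
    (-1 : K) ^ ((T.erase t).filter (· < t)).card *
        (-1 : K) ^ (((T.erase t).erase u).filter (· < u)).card =
      - ((-1 : K) ^ ((T.erase u).filter (· < u)).card *
        (-1 : K) ^ (((T.erase u).erase t).filter (· < t)).card) := by
  have h1 : (T.erase t).filter (· < t) = ((T.erase u).erase t).filter (· < t) := by
    ext x; simp only [Finset.mem_filter, Finset.mem_erase]
    constructor
    · rintro ⟨⟨a, b⟩, c⟩; exact ⟨⟨a, (c.trans h).ne, b⟩, c⟩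
    · rintro ⟨⟨a, b, c⟩, e⟩; exact ⟨⟨a, c⟩, e⟩
  have h2 : (T.erase u).filter (· < u) =
      insert t (((T.erase t).erase u).filter (· < u)) := by
    ext x; simp only [Finset.mem_filter, Finset.mem_erase, Finset.mem_insert]
    constructor
    · rintro ⟨⟨a, b⟩, c⟩
      by_cases e : x = t
      · exact Or.inl e
      · exact Or.inr ⟨⟨a, e, b⟩, c⟩
    · rintro (rfl | ⟨⟨a, b, c⟩, e⟩)
      · exact ⟨⟨h.ne, ht⟩, h⟩
      · exact ⟨⟨a, c⟩, e⟩
  rw [h1, h2, Finset.card_insert_of_notMem (by simp), pow_succ]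
  ring

lemma dComponent_swap (s : S → G) (ρ : Representation K G A) (T : Finset S) {t u : S}
    (ht : t ∈ T) (hu : u ∈ T) (h : t ≠ u) (hc : Commute (s t) (s u)) (v : A) :
    dComponent s ρ (T.erase t) t (dComponent s ρ ((T.erase t).erase u) u v) =
      - dComponent s ρ (T.erase u) u (dComponent s ρ ((T.erase u).erase t) t v) := by
  have hρ : ρ (s t) (ρ (s u) v) = ρ (s u) (ρ (s t) v) := by
    rw [← Module.End.mul_apply, ← Module.End.mul_apply, ← map_mul, ← map_mul, hc.eq]
  simp only [dComponent, LinearMap.smul_apply, LinearMap.add_apply, LinearMap.id_apply, map_add,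
    map_smul, hρ, smul_smul, ← smul_add, ← neg_smul]
  rw [show v + ρ (s u) v + (ρ (s t) v + ρ (s u) (ρ (s t) v)) =
    v + ρ (s t) v + (ρ (s u) v + ρ (s u) (ρ (s t) v)) by abel]
  congr 1
  rcases lt_or_gt_of_ne h with h | h
  · have := sign_swap (K := K) T ht h
    linear_combination this
  · have := sign_swap (K := K) T hu h
    rw [eq_neg_iff_add_eq_zero] at this ⊢
    rw [add_comm, mul_comm]
    refine Eq.trans ?_ this
    ring

lemma d_comp_d {s : S → G} (hs : ∀ a, s a * s a = 1) (ρ : Representation K G A) (k : ℕ)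
    (f : Cochain s ρ k) : d hs ρ (k + 1) (d hs ρ k f) = 0 := by
  funext T
  apply Subtype.ext
  let F : Finset S → A := fun U =>
    open scoped Classical in
    if h : U.card = k ∧ ∀ a ∈ U, ∀ b ∈ U, Commute (s a) (s b) then (f ⟨U, h⟩ : A) else 0
  have hF : ∀ U : CommutingSet s k, (f U : A) = F U.1 := fun U => by
    simp only [F]
    rw [dif_pos U.2]
    rfl
  have hd : ∀ U : CommutingSet s (k + 1), (d hs ρ k f U : A) =
      ∑ t ∈ U.1, dComponent s ρ (U.1.erase t) t (F (U.1.erase t)) := fun U => by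
    rw [← Finset.sum_coe_sort]
    simp only [d, LinearMap.coe_mk, AddHom.coe_mk, AddSubmonoidClass.coe_finsetSum, hF]
    rfl
  have hdd : (d hs ρ (k + 1) (d hs ρ k f) T : A) =
      ∑ t ∈ T.1, ∑ u ∈ T.1.erase t, dComponent s ρ (T.1.erase t) t
        (dComponent s ρ ((T.1.erase t).erase u) u (F ((T.1.erase t).erase u))) := by
    rw [← Finset.sum_coe_sort]
    rw [d, LinearMap.coe_mk, AddHom.coe_mk, AddSubmonoidClass.coe_finsetSum]
    refine Finset.sum_congr rfl fun t _ => ?_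
    rw [← map_sum]
    exact congrArg (dComponent s ρ (T.1.erase t) t) (hd (T.erase t t.2))
  rw [hdd, Finset.sum_sigma']
  refine Finset.sum_involution (fun x _ => ⟨x.2, x.1⟩) ?_ ?_ ?_ ?_
  · rintro ⟨t, u⟩ h
    simp only [Finset.mem_sigma, Finset.mem_erase] at h
    dsimp only
    rw [dComponent_swap s ρ T.1 h.1 h.2.2 (Ne.symm h.2.1) (T.2.2 t h.1 u h.2.2),
      Finset.erase_right_comm, neg_add_cancel]
  · rintro ⟨t, u⟩ h _ e
    simp only [Finset.mem_sigma, Finset.mem_erase] at h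
    exact h.2.1 (congrArg Sigma.fst e)
  · rintro ⟨t, u⟩ h
    simp only [Finset.mem_sigma, Finset.mem_erase] at h ⊢
    exact ⟨h.2.2, Ne.symm h.2.1, h.1⟩
  · rintro ⟨t, u⟩ _
    rfl

/-- The Coxeter cochain complex of a group `G` with a family `s` of generating involutions
and coefficients in a representation of `G`. A Coxeter group `G` with its set `S` of generators is
the case of interest. -/
def cochainComplex {s : S → G} (hs : ∀ a, s a * s a = 1) (ρ : Representation K G A) :
    CochainComplex (ModuleCat.{u} K) ℕ :=
  CochainComplex.of (fun k => ModuleCat.of K (Cochain s ρ k))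
    (fun k => ModuleCat.ofHom (d hs ρ k)) (fun k => by
      ext f : 2
      exact d_comp_d hs ρ k f)

/-- The Coxeter cohomology `H^k_C(G, A)`. -/
abbrev cohomology {s : S → G} (hs : ∀ a, s a * s a = 1) (ρ : Representation K G A) (k : ℕ) :
    ModuleCat.{u} K :=
  (cochainComplex hs ρ).homology k

/-- The map of cochains induced by an endomorphism of `A` that commutes with `G`. -/
def cochainMap (s : S → G) (ρ : Representation K G A) (φ : A →ₗ[K] A)
    (hφ : ∀ g, Commute (ρ g) φ) (k : ℕ) : Cochain s ρ k →ₗ[K] Cochain s ρ k :=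
  LinearMap.pi fun T => (φ.restrict (p := invariants s ρ T.1) (q := invariants s ρ T.1)
    (fun v hv g hg => by
      rw [← Module.End.mul_apply, (hφ g).eq, Module.End.mul_apply, hv g hg])).comp
        (LinearMap.proj T)

/-- The map of cochain complexes induced by an endomorphism of `A` that commutes with `G`. -/
def complexMap {s : S → G} (hs : ∀ a, s a * s a = 1) (ρ : Representation K G A) (φ : A →ₗ[K] A)
    (hφ : ∀ g, Commute (ρ g) φ) : cochainComplex hs ρ ⟶ cochainComplex hs ρ :=
  CochainComplex.ofHom (fun k => ModuleCat.ofHom (cochainMap s ρ φ hφ k)) (fun k => by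
    have h : ∀ t v, ρ (s t) (φ v) = φ (ρ (s t) v) := fun t v =>
      LinearMap.congr_fun (hφ (s t)).eq v
    simp only [cochainComplex, CochainComplex.of_d]
    ext f : 2
    funext T
    apply Subtype.ext
    simp only [ModuleCat.hom_comp, ModuleCat.hom_ofHom, LinearMap.comp_apply, d, cochainMap,
      LinearMap.coe_mk, AddHom.coe_mk, LinearMap.pi_apply, LinearMap.proj_apply,
      AddSubmonoidClass.coe_finsetSum, map_sum]
    refine Finset.sum_congr rfl fun t _ => ?_
    change dComponent s ρ (T.1.erase t) t (φ (f (T.erase t t.2))) =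
      φ (dComponent s ρ (T.1.erase t) t (f (T.erase t t.2)))
    simp only [dComponent, LinearMap.smul_apply, LinearMap.add_apply, LinearMap.id_apply,
      map_smul, map_add, h])

/-- The representation of a group `H` on `H^k_C(G, A)` induced by a representation of `H` on `A`
that commutes with the action of `G`. -/
def cohomologyRep {H : Type*} [Group H] {s : S → G} (hs : ∀ a, s a * s a = 1)
    (ρ : Representation K G A) (π : Representation K H A) (hπ : ∀ g h, Commute (ρ g) (π h))
    (k : ℕ) : Representation K H (cohomology hs ρ k) where
  toFun h := (HomologicalComplex.homologyMap (complexMap hs ρ (π h) (fun g => hπ g h)) k).hom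
  map_one' := by
    rw [show complexMap hs ρ (π 1) (fun g => hπ g 1) = 𝟙 _ by
      ext k f
      funext T
      exact Subtype.ext (LinearMap.congr_fun (map_one π) _)]
    rw [HomologicalComplex.homologyMap_id]
    rfl
  map_mul' h h' := by
    rw [show complexMap hs ρ (π (h * h')) (fun g => hπ g (h * h')) =
      complexMap hs ρ (π h') (fun g => hπ g h') ≫ complexMap hs ρ (π h) (fun g => hπ g h) by
        ext k f
        funext T
        exact Subtype.ext (LinearMap.congr_fun (map_mul π h h') _)]
    rw [HomologicalComplex.homologyMap_comp]
    rfl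

end Coxeter

namespace TypeA

/-- The generators `s_k = (k k+1)` of the Coxeter group `S_n` of type `A_{n-1}`. -/
def simpleTransposition (n : ℕ) (k : Fin (n - 1)) : Equiv.Perm (Fin n) :=
  Equiv.swap ⟨k, by omega⟩ ⟨k + 1, by omega⟩

lemma simpleTransposition_mul_self (n : ℕ) (k : Fin (n - 1)) :
    simpleTransposition n k * simpleTransposition n k = 1 :=
  Equiv.swap_mul_self _ _

open TensorProduct in
/-- The action of `S_n` on `V^{⊗n}`, where `σ` moves the `i`-th tensor factor to position
`σ i`. -/
def permRep (V : Type) [AddCommGroup V] [Module ℂ V] (n : ℕ) :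
    Representation ℂ (Equiv.Perm (Fin n)) (⨂[ℂ]^n V) where
  toFun σ := (PiTensorProduct.reindex ℂ (fun _ => V) σ).toLinearMap
  map_one' := by ext; simp; rfl
  map_mul' σ τ := by ext; simp; rfl

open TensorProduct in
/-- The diagonal action on `V^{⊗n}` of a group acting on `V`. -/
def powerRep {H : Type*} [Group H] {V : Type} [AddCommGroup V] [Module ℂ V]
    (π : Representation ℂ H V) (n : ℕ) : Representation ℂ H (⨂[ℂ]^n V) where
  toFun h := PiTensorProduct.map fun _ => π h
  map_one' := by ext; simp
  map_mul' h h' := by ext; simp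

lemma commute_permRep_powerRep {H : Type*} [Group H] {V : Type} [AddCommGroup V] [Module ℂ V]
    (π : Representation ℂ H V) (n : ℕ) (σ : Equiv.Perm (Fin n)) (h : H) :
    Commute (permRep V n σ) (powerRep π n h) := by
  ext f
  simp [permRep, powerRep]

/-- The space `H^j_C(A_{n-1}, V^{⊗n})`. -/
abbrev coxeterCohomology (V : Type) [AddCommGroup V] [Module ℂ V] (n j : ℕ) : ModuleCat ℂ :=
  Coxeter.cohomology (simpleTransposition_mul_self n) (permRep V n) j

/-- The representation on `H^j_C(A_{n-1}, V^{⊗n})` induced by a representation on `V`. -/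
def coxeterCohomologyRep {H : Type*} [Group H] {V : Type} [AddCommGroup V] [Module ℂ V]
    (π : Representation ℂ H V) (n j : ℕ) : Representation ℂ H (coxeterCohomology V n j) :=
  Coxeter.cohomologyRep (simpleTransposition_mul_self n) (permRep V n) (powerRep π n)
    (commute_permRep_powerRep π n) j

end TypeA

namespace FatPoint

open MvPolynomial

/-- The standard representation of `GL_m(ℂ)` on `ℂ^m`. -/
def standardRep (m : ℕ) : Representation ℂ (GL (Fin m) ℂ) (Fin m → ℂ) where
  toFun g := Matrix.toLin' g.1
  map_one' := by simp; rfl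
  map_mul' g h := by simp [Matrix.toLin'_mul]; rfl

/-- The ring `ℂ[x_1, …, x_m] / (x_1, …, x_m)^3`. -/
abbrev FatRing (m : ℕ) : Type :=
  MvPolynomial (Fin m) ℂ ⧸ (idealOfVars (Fin m) ℂ) ^ 3

/-- The augmentation `x_j ↦ 0`. -/
def augmentation (m : ℕ) : FatRing m →ₐ[ℂ] ℂ :=
  Ideal.Quotient.liftₐ _ (aeval fun _ => (0 : ℂ)) (by
    intro a ha
    have h1 := Ideal.pow_le_self (three_ne_zero) ha
    have h2 : idealOfVars (Fin m) ℂ ≤ RingHom.ker (aeval (R := ℂ) fun _ : Fin m => (0 : ℂ)) := by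
      rw [Ideal.span_le]
      rintro _ ⟨j, rfl⟩
      simp [RingHom.mem_ker]
    exact h2 h1)

lemma augmentation_X (m : ℕ) (j : Fin m) :
    augmentation m (Ideal.Quotient.mk ((idealOfVars (Fin m) ℂ) ^ 3) (X j)) = 0 :=
  aeval_X (R := ℂ) (fun _ : Fin m => (0 : ℂ)) j

/-- The linear substitution `x_j ↦ ∑ i, A i j • x_i`. -/
def substitution {m : ℕ} (A : Matrix (Fin m) (Fin m) ℂ) :
    MvPolynomial (Fin m) ℂ →ₐ[ℂ] MvPolynomial (Fin m) ℂ :=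
  aeval fun j => ∑ i, A i j • X i

lemma substitution_le {m : ℕ} (A : Matrix (Fin m) (Fin m) ℂ) :
    (idealOfVars (Fin m) ℂ) ^ 3 ≤ ((idealOfVars (Fin m) ℂ) ^ 3).comap (substitution A) := by
  have h : idealOfVars (Fin m) ℂ ≤ (idealOfVars (Fin m) ℂ).comap (substitution A) := by
    rw [Ideal.span_le]
    rintro _ ⟨j, rfl⟩
    simp only [Ideal.coe_comap, Set.mem_preimage, substitution, aeval_X, SetLike.mem_coe]
    refine Ideal.sum_mem _ fun i _ => ?_
    rw [smul_eq_C_mul]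
    exact Ideal.mul_mem_left _ _ (Ideal.subset_span ⟨i, rfl⟩)
  exact (Ideal.pow_right_mono h 3).trans (Ideal.le_comap_pow _ 3)

/-- The endomorphism `x_j ↦ ∑ i, A i j • x_i` of `ℂ[x_1, …, x_m] / (x_1, …, x_m)^3`. -/
def substMap {m : ℕ} (A : Matrix (Fin m) (Fin m) ℂ) : FatRing m →ₐ[ℂ] FatRing m :=
  Ideal.quotientMapₐ _ (substitution A) (substitution_le A)

lemma substMap_one (m : ℕ) : substMap (1 : Matrix (Fin m) (Fin m) ℂ) = AlgHom.id ℂ _ := by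
  refine Ideal.Quotient.algHom_ext _ (MvPolynomial.algHom_ext fun j => ?_)
  simp [substMap, substitution, Matrix.one_apply]

lemma substMap_mul {m : ℕ} (A B : Matrix (Fin m) (Fin m) ℂ) :
    substMap (A * B) = (substMap A).comp (substMap B) := by
  refine Ideal.Quotient.algHom_ext _ (MvPolynomial.algHom_ext fun j => ?_)
  simp [substMap, substitution, Matrix.mul_apply, Finset.sum_smul, Finset.smul_sum, smul_smul]
  rw [Finset.sum_comm]
  simp [mul_comm]

/-- The action of `GL_m(ℂ)` by linear substitutions, for which the linear forms are the standard
representation with basis `x_1, …, x_m`. -/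
def glAction (m : ℕ) : GL (Fin m) ℂ →* (FatRing m ≃ₐ[ℂ] FatRing m) where
  toFun g := AlgEquiv.ofAlgHom (substMap g.1) (substMap (g⁻¹).1)
    (by rw [← substMap_mul, ← Units.val_mul, mul_inv_cancel, Units.val_one, substMap_one])
    (by rw [← substMap_mul, ← Units.val_mul, inv_mul_cancel, Units.val_one, substMap_one])
  map_one' := by
    ext x
    exact DFunLike.congr_fun (substMap_one m) x
  map_mul' g h := by
    ext x
    exact DFunLike.congr_fun (substMap_mul g.1 h.1) x

lemma augmentation_glAction (m : ℕ) (g : GL (Fin m) ℂ) (r : FatRing m) :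
    augmentation m (glAction m g r) = augmentation m r := by
  have : (augmentation m).comp (substMap g.1) = augmentation m := by
    refine Ideal.Quotient.algHom_ext _ (MvPolynomial.algHom_ext fun j => ?_)
    simp [substMap, substitution, augmentation_X]
  exact DFunLike.congr_fun this r

end FatPoint

end

/-!
Let `𝔪` be the augmentation ideal of `R` and let `V ⊆ 𝔪` be the space of linear forms, so that
`𝔪 = V ⊕ V·V` with `V·V ≅ Sym² V` and `𝔪³ = 0`. The group acts on everything in sight, and the
decomposition is equivariant.

*The bar complex.* The normalized bar resolution `R ⊗ 𝔪^{⊗n}` (`AugTor.Bar.resolution`) is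
functorial in `R`, hence an automorphism of `R` lifts to it by acting on all factors. The
representation on `Tor` may be computed from any projective resolution and any semilinear lift
(`AugTor.torEnd_eq`); so `Tor_i` is the homology in degree `i` of the complex `𝔪^{⊗n}`, whose
differential multiplies neighbouring factors, with alternating signs.

*Words.* Since `𝔪 = V ⊕ V·V`, the space `𝔪^{⊗n}` is the direct sum, over all ways to write `n` as
a number of parts with one or two letters, of the spaces spanned by words in `N` letters from `V`.
The set `T` of those `t` for which letters `t` and `t + 1` lie in the same part contains no two
neighbours, that is, it is a set of commuting generators of `S_N`, and `N = n + |T|`. The part of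
`𝔪^{⊗n}` belonging to `T` is the space of coinvariants of `V^{⊗N}` under `⟨T⟩`, because letters
multiplied in `𝔪` commute and there are no other relations. As `𝔪³ = 0`, the bar differential adds
to `T`, with a sign, each generator that keeps it commuting (`AugTor.CubeZero.diff_word`). It
preserves `N`, so that the bar complex is a direct sum over `N`.

*Comparison.* In characteristic zero, invariants map isomorphically onto coinvariants, by averaging.
Under this identification the component `v + s(v)` of the Coxeter differential becomes twice the
multiplication of the letters `s` and `s + 1`; a factor `2^{-k}` on `k`-cochains and the sign
`(-1)^{∑ T}` turn the identification into a map `AugTor.CubeZero.coxeterMap` that is compatible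
with the differentials (`AugTor.CubeZero.diff_coxeterMap`) and with the group
(`AugTor.CubeZero.map_coxeterMap`). For `n ≥ 1` these maps, for `N = n + j` and `0 ≤ j ≤ n`, form an
isomorphism onto `𝔪^{⊗n}`: they are jointly surjective because words span
(`AugTor.CubeZero.mem_span_coxeterMap`), and jointly injective because the coordinates of a product
of two letters in `Sym² V`, read off by second derivatives, determine an invariant tensor
(`AugTor.CubeZero.eq_zero_of_sum_coxeterMap_eq_zero`). Taking homology gives the theorem.
-/

/-! ### Independence of the resolution, and homology of modules -/

noncomputable section

open CategoryTheory MonoidalCategory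

namespace AugTor

universe u
variable {K R : Type u} [Field K] [CommRing R] [Algebra K R]

/-- The isomorphisms `torIso` are compatible with comparison maps of resolutions. -/
lemma torIso_comp_homologyMap (ε : R →ₐ[K] K) (P Q : ProjectiveResolution (residue ε))
    (φ : P.complex ⟶ Q.complex)
    (hφ : φ ≫ Q.π = P.π ≫ (ChainComplex.single₀ (ModuleCat.{u} R)).map (𝟙 _)) (i : ℕ) :
    (torIso ε P i).hom ≫ HomologicalComplex.homologyMap
      (((residueTensor ε ⋙ scalars K R).mapHomologicalComplex _).map φ) i =
      (torIso ε Q i).hom := by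
  have h := ProjectiveResolution.isoLeftDerivedObj_hom_naturality (𝟙 _) P Q φ
    (HomologicalComplex.congr_hom hφ 0) (residueTensor ε) i
  rw [CategoryTheory.Functor.map_id, Category.id_comp] at h
  have h2 := ShortComplex.mapHomologyIso_inv_naturality ((HomologicalComplex.shortComplexFunctor
    (ModuleCat.{u} R) _ i).map (((residueTensor ε).mapHomologicalComplex _).map φ)) (scalars K R)
  refine (Category.assoc _ _ _).trans ((congrArg (_ ≫ ·) h2.symm).trans ?_)
  refine (Category.assoc _ _ _).symm.trans (congrArg (· ≫ _) ?_)
  exact ((scalars K R).map_comp _ _).symm.trans (congrArg _ h.symm)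

/-- The endomorphism `torEnd` can be computed from any projective resolution and any semilinear
lift to it. -/
lemma torEnd_eq (ε : R →ₐ[K] K) (P : ProjectiveResolution (residue ε)) (σ : R ≃ₐ[K] R)
    (h : ∀ r, ε (σ r) = ε r) (f : SemilinearLift ε P σ) (i : ℕ) :
    torEnd ε σ h i ≫ (torIso ε P i).hom =
      (torIso ε P i).hom ≫ HomologicalComplex.homologyMap (f.chainMap h) i := by
  let Q := projectiveResolution (residue ε)
  let g : SemilinearLift ε Q σ := (SemilinearLift.exists ε Q σ h).some
  let φ : Q.complex ⟶ P.complex := ProjectiveResolution.lift (𝟙 _) Q P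
  have hφ : φ ≫ P.π = Q.π ≫ (ChainComplex.single₀ (ModuleCat.{u} R)).map (𝟙 _) :=
    ProjectiveResolution.lift_commutes _ _ _
  -- Both composites around the square are semilinear chain maps lifting the identity of `K`; viewed
  -- as linear chain maps from `Q` to the twist of `P`, they are homotopic.
  let φ' : (twistResolution σ Q).complex ⟶ (twistResolution σ P).complex :=
    ((twist σ).mapHomologicalComplex _).map φ
  have hφ' : φ' ≫ (twistResolution σ P).π = (twistResolution σ Q).π := by
    ext x
    have := ConcreteCategory.congr_hom (HomologicalComplex.congr_hom hφ 0) x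
    simp at this
    simp [twistResolution, φ']
    exact this
  let τ := (NatTrans.mapHomologicalComplex (twistTrans ε σ h) (ComplexShape.down ℕ)).app P.complex
  have e1 : g.chainMap h ≫ ((residueTensor ε ⋙ scalars K R).mapHomologicalComplex _).map φ =
      ((residueTensor ε ⋙ scalars K R).mapHomologicalComplex _).map (g.toHom ≫ φ') ≫ τ := by
    ext n : 1
    exact tensor_hom_ext fun c y => rfl
  have e2 : ((residueTensor ε ⋙ scalars K R).mapHomologicalComplex _).map φ ≫ f.chainMap h =
      ((residueTensor ε ⋙ scalars K R).mapHomologicalComplex _).map (φ ≫ f.toHom) ≫ τ := by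
    ext n : 1
    exact tensor_hom_ext fun c y => rfl
  have key : HomologicalComplex.homologyMap (g.chainMap h) i ≫ HomologicalComplex.homologyMap
      (((residueTensor ε ⋙ scalars K R).mapHomologicalComplex _).map φ) i =
      HomologicalComplex.homologyMap
      (((residueTensor ε ⋙ scalars K R).mapHomologicalComplex _).map φ) i ≫
      HomologicalComplex.homologyMap (f.chainMap h) i := by
    rw [← HomologicalComplex.homologyMap_comp, ← HomologicalComplex.homologyMap_comp, e1, e2]
    refine Homotopy.homologyMap_eq (Homotopy.compRight (Functor.mapHomotopy _ ?_) _) i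
    refine ProjectiveResolution.liftHomotopy (toTwist (residueSemilinear ε σ h)) _ _ ?_ ?_
    · rw [Category.assoc, hφ', g.toHom_π h]
    · rw [Category.assoc, f.toHom_π h, ← Category.assoc, hφ]
      simp
  have hg : torEnd ε σ h i = (torIso ε Q i).hom ≫
      HomologicalComplex.homologyMap (g.chainMap h) i ≫ (torIso ε Q i).inv := rfl
  rw [← torIso_comp_homologyMap ε Q P φ hφ, hg]
  simp only [Category.assoc, Iso.inv_hom_id_assoc]
  rw [key]

end AugTor

section Homology
universe u v w
variable {k : Type u} [Field k]

namespace CategoryTheory.ShortComplex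

/-- The linear map that sends a cycle to its homology class. -/
def classMap (S : ShortComplex (ModuleCat.{v} k)) : LinearMap.ker S.g.hom →ₗ[k] S.homology :=
  S.homologyπ.hom ∘ₗ (S.moduleCatCyclesIso.inv.hom : LinearMap.ker S.g.hom →ₗ[k] S.cycles)

lemma classMap_surjective (S : ShortComplex (ModuleCat.{v} k)) :
    Function.Surjective S.classMap := by
  have h1 : Function.Surjective S.homologyπ := (ModuleCat.epi_iff_surjective _).1 inferInstance
  have h2 : Function.Surjective S.moduleCatCyclesIso.inv :=
    (ModuleCat.epi_iff_surjective _).1 inferInstance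
  exact h1.comp h2

lemma classMap_eq_zero_iff (S : ShortComplex (ModuleCat.{v} k))
    (z : LinearMap.ker S.g.hom) : S.classMap z = 0 ↔ z.1 ∈ LinearMap.range S.f.hom := by
  have h : S.classMap z =
      S.moduleCatHomologyIso.inv ((LinearMap.range S.moduleCatToCycles).mkQ z) :=
    ConcreteCategory.congr_hom S.moduleCatCyclesIso_inv_π z
  have hinj : Function.Injective S.moduleCatHomologyIso.inv :=
    (ModuleCat.mono_iff_injective _).1 inferInstance
  rw [h]
  refine (map_eq_zero_iff S.moduleCatHomologyIso.inv.hom hinj).trans ?_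
  refine (Submodule.Quotient.mk_eq_zero _).trans ?_
  constructor
  · rintro ⟨x, rfl⟩
    exact ⟨x, rfl⟩
  · rintro ⟨x, hx⟩
    exact ⟨x, Subtype.ext hx⟩

/-- The map induced on homology, in terms of representing cycles. -/
lemma homologyMap_classMap {S S' : ShortComplex (ModuleCat.{v} k)}
    (φ : S ⟶ S') (z : LinearMap.ker S.g.hom) (z' : LinearMap.ker S'.g.hom)
    (hz : φ.τ₂.hom z.1 = z'.1) :
    (ShortComplex.homologyMap φ).hom (S.classMap z) = S'.classMap z' := by
  have h1 := ConcreteCategory.congr_hom (ShortComplex.homologyπ_naturality φ)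
    (S.moduleCatCyclesIso.inv z)
  refine h1.trans ?_
  change S'.homologyπ _ = S'.homologyπ _
  congr 1
  have hinj : Function.Injective S'.iCycles :=
    (ModuleCat.mono_iff_injective _).1 inferInstance
  apply hinj
  have h2 := ConcreteCategory.congr_hom (ShortComplex.cyclesMap_i φ) (S.moduleCatCyclesIso.inv z)
  refine h2.trans ?_
  have h3 := ConcreteCategory.congr_hom S.moduleCatCyclesIso_inv_iCycles z
  have h4 := ConcreteCategory.congr_hom S'.moduleCatCyclesIso_inv_iCycles z'
  refine Eq.trans ?_ h4.symm
  refine (congrArg φ.τ₂ h3).trans ?_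
  exact hz

/-- A linear isomorphism from a finite product of modules `T_j.X₂` to `S.X₂` that matches up
cycles and boundaries induces an isomorphism between `⨁ H(T_j)` and `H(S)`, which commutes with
all maps that `Φ` commutes with. -/
lemma exists_homologyEquiv {ι : Type} [Fintype ι] [DecidableEq ι]
    (S : ShortComplex (ModuleCat.{v} k)) (T : ι → ShortComplex (ModuleCat.{w} k))
    (Φ : (∀ j, (T j).X₂) ≃ₗ[k] S.X₂)
    (hker : ∀ c, S.g.hom (Φ c) = 0 ↔ ∀ j, (T j).g.hom (c j) = 0)
    (hran : ∀ c, Φ c ∈ LinearMap.range S.f.hom ↔ ∀ j, c j ∈ LinearMap.range (T j).f.hom) :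
    ∃ e : S.homology ≃ₗ[k] DirectSum ι (fun j => (T j).homology),
      ∀ (φ : S ⟶ S) (ψ : ∀ j, T j ⟶ T j),
        (∀ c, φ.τ₂.hom (Φ c) = Φ (fun j => (ψ j).τ₂.hom (c j))) →
        ∀ x, e ((ShortComplex.homologyMap φ).hom x) =
          DirectSum.lmap (fun j => (ShortComplex.homologyMap (ψ j)).hom) (e x) := by
  -- `p` sends a cycle to its components, and `q` to the homology classes of its components. The
  -- map `q` is onto and has the boundaries as its kernel.
  let p : LinearMap.ker S.g.hom →ₗ[k] ∀ j, LinearMap.ker (T j).g.hom := LinearMap.pi fun j =>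
    ((LinearMap.proj j ∘ₗ Φ.symm.toLinearMap).restrict (fun z hz => by
      have := (hker (Φ.symm z)).1 (by rw [Φ.apply_symm_apply]; exact hz)
      exact this j))
  have hp : ∀ z j, ((p z j : LinearMap.ker (T j).g.hom) : (T j).X₂) = Φ.symm z.1 j :=
    fun z j => rfl
  let q : LinearMap.ker S.g.hom →ₗ[k] DirectSum ι (fun j => (T j).homology) :=
    (DirectSum.linearEquivFunOnFintype k ι (fun j => (T j).homology)).symm.toLinearMap ∘ₗ
      LinearMap.pi (fun j => (T j).classMap ∘ₗ LinearMap.proj j ∘ₗ p)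
  have hq : ∀ z j, q z j = (T j).classMap (p z j) := fun z j => rfl
  have hqs : Function.Surjective q := by
    intro y
    choose z hz using fun j => (T j).classMap_surjective (y j)
    refine ⟨⟨Φ (fun j => (z j).1), (hker _).2 fun j => (z j).2⟩, ?_⟩
    refine DFinsupp.ext fun j => ?_
    refine (hq _ j).trans ?_
    rw [← hz]
    congr 1
    apply Subtype.ext
    rw [hp, Φ.symm_apply_apply]
  have hk : LinearMap.ker S.classMap = LinearMap.ker q := by
    ext z
    rw [LinearMap.mem_ker, LinearMap.mem_ker, classMap_eq_zero_iff, ← Φ.apply_symm_apply z.1, hran]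
    rw [DFinsupp.ext_iff]
    refine forall_congr' fun j => ?_
    rw [show (q z) j = _ from hq z j]
    exact ((T j).classMap_eq_zero_iff (p z j)).symm
  let e : S.homology ≃ₗ[k] DirectSum ι (fun j => (T j).homology) :=
    (LinearMap.quotKerEquivOfSurjective _ S.classMap_surjective).symm ≪≫ₗ
      Submodule.quotEquivOfEq _ _ hk ≪≫ₗ LinearMap.quotKerEquivOfSurjective _ hqs
  have he : ∀ z, e (S.classMap z) = q z := fun z => by
    have : (LinearMap.quotKerEquivOfSurjective _ S.classMap_surjective).symm (S.classMap z) =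
        Submodule.Quotient.mk z := by
      rw [LinearEquiv.symm_apply_eq]
      rfl
    simp only [e, LinearEquiv.trans_apply, this]
    rfl
  refine ⟨e, fun φ ψ hφ x => ?_⟩
  obtain ⟨z, rfl⟩ := S.classMap_surjective x
  have hz' : φ.τ₂.hom z.1 ∈ LinearMap.ker S.g.hom := by
    have := ConcreteCategory.congr_hom φ.comm₂₃ z.1
    refine LinearMap.mem_ker.2 (Eq.trans this ?_)
    change φ.τ₃.hom (S.g.hom z.1) = 0
    rw [LinearMap.mem_ker.1 z.2, map_zero]
  rw [homologyMap_classMap φ z ⟨_, hz'⟩ rfl, he, he]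
  refine DFinsupp.ext fun j => ?_
  rw [DirectSum.lmap_apply]
  refine (hq _ j).trans ?_
  refine Eq.trans ?_ (congrArg _ (hq _ j).symm)
  refine (homologyMap_classMap (ψ j) _ _ ?_).symm
  rw [hp, hp]
  apply congrFun (a := j) (f := fun j => (ψ j).τ₂.hom (Φ.symm z.1 j))
  rw [LinearEquiv.eq_symm_apply, ← hφ, Φ.apply_symm_apply]

end CategoryTheory.ShortComplex

variable {ι : Type*} {s : ComplexShape ι}
  (C : HomologicalComplex (ModuleCat.{v} k) s)

lemma HomologicalComplex.sc_g_apply_eq_zero_iff {i j : ι} (h : s.next i = j) (x : C.X i) :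
    (C.sc i).g.hom x = 0 ↔ (C.d i j).hom x = 0 := by
  subst h
  rfl

lemma HomologicalComplex.mem_range_sc_f_iff {i j : ι} (h : s.prev j = i) (x : C.X j) :
    x ∈ LinearMap.range (C.sc j).f.hom ↔ ∃ y, (C.d i j).hom y = x := by
  subst h
  rfl

end Homology

end

/-! ### The normalized bar resolution -/

noncomputable section

open CategoryTheory MonoidalCategory

namespace AugTor

universe u
variable {K R : Type u} [Field K] [CommRing R] [Algebra K R]

/-- The vector space `𝔪^{⊗n}`, where `𝔪` is the kernel of the augmentation `ε`. It is defined by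
`𝔪^{⊗(n+1)} = 𝔪 ⊗ 𝔪^{⊗n}`, so that proofs by induction on `n` split off the first factor. -/
def barSpace (ε : R →ₐ[K] K) : ℕ → ModuleCat.{u} K
  | 0 => ModuleCat.of K K
  | n + 1 => ModuleCat.of K (TensorProduct K (RingHom.ker ε) (barSpace ε n))

namespace Bar

variable (ε : R →ₐ[K] K)

/-- The generator of `𝔪^{⊗0} = K`. -/
def unit : barSpace ε 0 := (1 : K)

/-- The identification of `𝔪^{⊗0}` with `K`. -/
def zeroEquiv : barSpace ε 0 ≃ₗ[K] K := LinearEquiv.refl K K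

lemma zeroEquiv_unit : zeroEquiv ε (unit ε) = 1 := rfl

lemma eq_smul_unit (w : barSpace ε 0) : w = zeroEquiv ε w • unit ε :=
  (mul_one (M := K) _).symm

/-- The bilinear map `(a, w) ↦ a ⊗ w` from `𝔪 × 𝔪^{⊗n}` to `𝔪^{⊗(n+1)}`. -/
def cons (n : ℕ) : RingHom.ker ε →ₗ[K] barSpace ε n →ₗ[K] barSpace ε (n + 1) :=
  TensorProduct.mk K (RingHom.ker ε) (barSpace ε n)

variable {ε}

/-- The linear map on `𝔪^{⊗(n+1)} = 𝔪 ⊗ 𝔪^{⊗n}` given by a bilinear map. -/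
def consLift {n : ℕ} {X : Type*} [AddCommGroup X] [Module K X]
    (f : RingHom.ker ε →ₗ[K] barSpace ε n →ₗ[K] X) : barSpace ε (n + 1) →ₗ[K] X :=
  TensorProduct.lift f

lemma consLift_cons {n : ℕ} {X : Type*} [AddCommGroup X] [Module K X]
    (f : RingHom.ker ε →ₗ[K] barSpace ε n →ₗ[K] X) (a : RingHom.ker ε) (w : barSpace ε n) :
    consLift f (cons ε n a w) = f a w :=
  TensorProduct.lift.tmul (f' := f) a w

lemma cons_ext {n : ℕ} {X : Type*} [AddCommGroup X] [Module K X]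
    {f g : barSpace ε (n + 1) →ₗ[K] X}
    (h : ∀ a w, f (cons ε n a w) = g (cons ε n a w)) : f = g :=
  TensorProduct.ext' (R := K) (M := RingHom.ker ε) (N := barSpace ε n) (g := f) (h := g) h

lemma span_cons (n : ℕ) :
    Submodule.span K {x | ∃ a w, cons ε n a w = x} = ⊤ :=
  TensorProduct.span_tmul_eq_top K (RingHom.ker ε) (barSpace ε n)

variable (ε) in
/-- The action of `R` on `𝔪^{⊗n}` by multiplication on the first factor, and through the
augmentation for `n = 0`. -/
def act : ∀ n, R →ₗ[K] barSpace ε n →ₗ[K] barSpace ε n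
  | 0 => (LinearMap.lsmul K (barSpace ε 0)).comp ε.toLinearMap
  | n + 1 => LinearMap.mk₂ K
      (fun r => consLift ((cons ε n).comp (Algebra.lsmul K K (RingHom.ker ε) r)))
      (fun r s w => by
        rw [← LinearMap.add_apply]
        refine LinearMap.congr_fun (cons_ext fun a w => ?_) w
        simp [consLift_cons])
      (fun c r w => by
        rw [← LinearMap.smul_apply]
        refine LinearMap.congr_fun (cons_ext fun a w => ?_) w
        simp [consLift_cons])
      (fun r w w' => map_add _ w w')
      (fun c r w => map_smul _ c w)

lemma act_zero (r : R) (w : barSpace ε 0) : act ε 0 r w = ε r • w := rfl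

lemma act_cons (n : ℕ) (r : R) (a : RingHom.ker ε) (w : barSpace ε n) :
    act ε (n + 1) r (cons ε n a w) = cons ε n (r • a) w :=
  consLift_cons _ _ _

lemma act_mul (n : ℕ) (r s : R) (w : barSpace ε n) :
    act ε n (r * s) w = act ε n r (act ε n s w) := by
  cases n with
  | zero => rw [act_zero, act_zero, act_zero, map_mul, mul_smul]
  | succ n =>
    refine LinearMap.congr_fun (f := act ε (n + 1) (r * s))
      (g := act ε (n + 1) r ∘ₗ act ε (n + 1) s) (cons_ext fun a w => ?_) w
    rw [LinearMap.comp_apply, act_cons, act_cons, act_cons, mul_smul]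

variable (ε) in
/-- The inclusion of `𝔪` in `R`. -/
def incl : RingHom.ker ε →ₗ[K] R :=
  (RingHom.ker ε).subtype.restrictScalars K

variable (ε) in
/-- The differential `[a₁|…|aₙ] ↦ ∑ (-1)^(i-1) [a₁|…|aᵢaᵢ₊₁|…|aₙ]` of the complex `𝔪^{⊗n}`,
defined recursively: the term `i = 1` is the action of `a₁` on `[a₂|…|aₙ]`. -/
def diff : ∀ n, barSpace ε (n + 1) →ₗ[K] barSpace ε n
  | 0 => 0
  | n + 1 => consLift ((act ε (n + 1)).comp (incl ε) -
      (cons ε n).compl₂ (diff n))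

lemma diff_zero (w : barSpace ε 1) : diff ε 0 w = 0 := rfl

lemma diff_cons (n : ℕ) (a : RingHom.ker ε) (w : barSpace ε (n + 1)) :
    diff ε (n + 1) (cons ε (n + 1) a w) = act ε (n + 1) a w - cons ε n a (diff ε n w) :=
  consLift_cons _ _ _

/-- The differential is linear for the action of `R` on the first factor. -/
lemma diff_act (n : ℕ) (r : R) (w : barSpace ε (n + 1)) :
    diff ε n (act ε (n + 1) r w) = act ε n r (diff ε n w) := by
  cases n with
  | zero => rw [diff_zero, diff_zero, map_zero]
  | succ n =>
    refine LinearMap.congr_fun (f := diff ε (n + 1) ∘ₗ act ε (n + 2) r)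
      (g := act ε (n + 1) r ∘ₗ diff ε (n + 1)) (cons_ext fun a w => ?_) w
    rw [LinearMap.comp_apply, LinearMap.comp_apply, act_cons, diff_cons, diff_cons, map_sub,
      act_cons, ← act_mul]
    rfl

lemma diff_diff (n : ℕ) (w : barSpace ε (n + 2)) : diff ε n (diff ε (n + 1) w) = 0 := by
  induction n with
  | zero => rw [diff_zero]
  | succ n ih =>
    refine LinearMap.congr_fun (f := diff ε (n + 1) ∘ₗ diff ε (n + 2)) (g := 0)
      (cons_ext fun a w => ?_) w
    rw [LinearMap.comp_apply, diff_cons, map_sub, diff_act, diff_cons, ih, map_zero, sub_zero,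
      sub_self, LinearMap.zero_apply]

open TensorProduct

variable (ε) in
/-- The inclusion `𝔪 ⊗ 𝔪^{⊗n} → R ⊗ 𝔪^{⊗n}`. -/
def consIncl (n : ℕ) : barSpace ε (n + 1) →ₗ[K] R ⊗[K] barSpace ε n :=
  consLift ((TensorProduct.mk K R (barSpace ε n)).comp (incl ε))

lemma consIncl_cons (n : ℕ) (a : RingHom.ker ε) (w : barSpace ε n) :
    consIncl ε n (cons ε n a w) = (a : R) ⊗ₜ w :=
  consLift_cons _ _ _

lemma consIncl_act (n : ℕ) (r : R) (w : barSpace ε (n + 1)) :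
    consIncl ε n (act ε (n + 1) r w) = r • consIncl ε n w := by
  refine LinearMap.congr_fun (f := consIncl ε n ∘ₗ act ε (n + 1) r)
    (g := Algebra.lsmul K K _ r ∘ₗ consIncl ε n) (cons_ext fun a w => ?_) w
  rw [LinearMap.comp_apply, LinearMap.comp_apply, act_cons, consIncl_cons, consIncl_cons]
  rfl

variable (ε) in
/-- The differential of the bar resolution `R ⊗ 𝔪^{⊗n}`. Its sign is chosen so that it becomes
`diff` after tensoring with `K`. -/
def resDiff (n : ℕ) : R ⊗[K] barSpace ε (n + 1) →ₗ[R] R ⊗[K] barSpace ε n :=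
  LinearMap.liftBaseChange R (TensorProduct.mk K R (barSpace ε n) 1 ∘ₗ diff ε n - consIncl ε n)

lemma resDiff_tmul (n : ℕ) (r : R) (w : barSpace ε (n + 1)) :
    resDiff ε n (r ⊗ₜ w) = r ⊗ₜ diff ε n w - r • consIncl ε n w := by
  simp [resDiff, smul_sub, TensorProduct.smul_tmul']

lemma resDiff_consIncl (n : ℕ) (w : barSpace ε (n + 2)) :
    resDiff ε n (consIncl ε (n + 1) w) = - consIncl ε n (diff ε (n + 1) w) := by
  refine LinearMap.congr_fun (f := (resDiff ε n).restrictScalars K ∘ₗ consIncl ε (n + 1))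
    (g := - (consIncl ε n ∘ₗ diff ε (n + 1))) (cons_ext fun a w => ?_) w
  rw [LinearMap.comp_apply, LinearMap.neg_apply, LinearMap.comp_apply, consIncl_cons,
    LinearMap.restrictScalars_apply, resDiff_tmul, diff_cons, map_sub, consIncl_cons, consIncl_act,
    neg_sub]

lemma resDiff_resDiff (n : ℕ) (x : R ⊗[K] barSpace ε (n + 2)) :
    resDiff ε n (resDiff ε (n + 1) x) = 0 := by
  induction x using TensorProduct.induction_on with
  | zero => rw [map_zero, map_zero]
  | add x y hx hy => rw [map_add, map_add, hx, hy, add_zero]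
  | tmul r w =>
    rw [resDiff_tmul, map_sub, map_smul, resDiff_tmul, resDiff_consIncl, diff_diff,
      TensorProduct.tmul_zero, smul_neg, zero_sub, sub_neg_eq_add, neg_add_cancel]

variable (ε) in
/-- The projection `r ↦ r - ε r` from `R` onto `𝔪`. -/
def proj : R →ₗ[K] RingHom.ker ε :=
  LinearMap.codRestrict ((RingHom.ker ε).restrictScalars K)
    (LinearMap.id - (Algebra.linearMap K R).comp ε.toLinearMap) (fun r => by
      change ε (r - algebraMap K R (ε r)) = 0
      rw [map_sub, AlgHom.commutes]
      exact sub_self _)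

lemma coe_proj (r : R) : (proj ε r : R) = r - algebraMap K R (ε r) := rfl

variable (ε) in
/-- The contracting homotopy `r ⊗ w ↦ - 1 ⊗ ((r - ε r) ⊗ w)` of the bar resolution. -/
def homotopy (n : ℕ) : R ⊗[K] barSpace ε n →ₗ[K] R ⊗[K] barSpace ε (n + 1) :=
  - TensorProduct.lift ((cons ε n).compr₂ (TensorProduct.mk K R _ 1) ∘ₗ proj ε)

lemma homotopy_tmul (n : ℕ) (r : R) (w : barSpace ε n) :
    homotopy ε n (r ⊗ₜ w) = - 1 ⊗ₜ cons ε n (proj ε r) w := by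
  simp [homotopy]

lemma homotopy_formula (n : ℕ) (x : R ⊗[K] barSpace ε (n + 1)) :
    resDiff ε (n + 1) (homotopy ε (n + 1) x) + homotopy ε n (resDiff ε n x) = x := by
  induction x using TensorProduct.induction_on with
  | zero => simp
  | add x y hx hy =>
    rw [map_add, map_add, map_add, map_add, add_add_add_comm, hx, hy]
  | tmul r w =>
    refine LinearMap.congr_fun (f := ((resDiff ε (n + 1)).restrictScalars K ∘ₗ homotopy ε (n + 1) +
      homotopy ε n ∘ₗ (resDiff ε n).restrictScalars K) ∘ₗ TensorProduct.mk K R _ r)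
      (g := TensorProduct.mk K R _ r) (cons_ext fun b w => ?_) w
    simp only [LinearMap.comp_apply, LinearMap.add_apply, TensorProduct.mk_apply,
      LinearMap.restrictScalars_apply]
    rw [homotopy_tmul, map_neg, resDiff_tmul, resDiff_tmul, map_sub, homotopy_tmul,
      consIncl_cons, consIncl_cons, TensorProduct.smul_tmul' r, homotopy_tmul, diff_cons, one_smul,
      smul_eq_mul, act_cons]
    have h1 : proj ε (r * b) = r • b := by
      apply Subtype.ext
      rw [coe_proj, map_mul, show ε b = 0 from b.2, mul_zero, map_zero, sub_zero]
      rfl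
    have h2 : ((proj ε r : RingHom.ker ε) : R) • b = r • b - ε r • b := by
      rw [coe_proj, sub_smul, algebraMap_smul]
    have h3 : cons ε n (r • b - ε r • b) w = cons ε n (r • b) w - ε r • cons ε n b w := by
      rw [map_sub, LinearMap.sub_apply, (cons ε n).map_smul, LinearMap.smul_apply]
    rw [h1, h2, h3, coe_proj, TensorProduct.sub_tmul, TensorProduct.tmul_sub,
      TensorProduct.tmul_sub, TensorProduct.tmul_smul, TensorProduct.smul_tmul',
      Algebra.algebraMap_eq_smul_one]
    abel

variable (ε) in
/-- The `K`-linear map underlying the augmentation of the bar resolution. -/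
def resAugLin : R ⊗[K] barSpace ε 0 →ₗ[K] K :=
  TensorProduct.lift ((LinearMap.mul K K).compl₁₂ ε.toLinearMap (zeroEquiv ε).toLinearMap)

lemma resAugLin_tmul (r : R) (w : barSpace ε 0) :
    resAugLin ε (r ⊗ₜ w) = ε r * zeroEquiv ε w :=
  rfl

variable (ε) in
/-- The augmentation `R ⊗ 𝔪^{⊗0} → K` of the bar resolution. -/
def resAug : R ⊗[K] barSpace ε 0 →ₗ[R] residue ε where
  toFun := resAugLin ε
  map_add' := map_add (resAugLin ε)
  map_smul' r x := by
    change resAugLin ε (r • x) = ε r * resAugLin ε x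
    induction x using TensorProduct.induction_on with
    | zero => rw [smul_zero, map_zero, mul_zero]
    | add x y hx hy => rw [smul_add, map_add, hx, hy, map_add, mul_add]
    | tmul s w =>
      rw [TensorProduct.smul_tmul', resAugLin_tmul, resAugLin_tmul, smul_eq_mul, map_mul,
        mul_assoc]

lemma resAugLin_resDiff (x : R ⊗[K] barSpace ε 1) : resAugLin ε (resDiff ε 0 x) = 0 := by
  induction x using TensorProduct.induction_on with
  | zero => rw [map_zero, map_zero]
  | add x y hx hy => rw [map_add, map_add, hx, hy, add_zero]
  | tmul r w =>
    refine LinearMap.congr_fun (f := resAugLin ε ∘ₗ (resDiff ε 0).restrictScalars K ∘ₗ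
      TensorProduct.mk K R _ r) (g := 0) (cons_ext fun a w => ?_) w
    rw [LinearMap.comp_apply, LinearMap.comp_apply, LinearMap.restrictScalars_apply,
      TensorProduct.mk_apply, resDiff_tmul, diff_zero, TensorProduct.tmul_zero, zero_sub, map_neg,
      consIncl_cons, TensorProduct.smul_tmul', resAugLin_tmul, smul_eq_mul, map_mul,
      show ε a = 0 from a.2, mul_zero, zero_mul, neg_zero, LinearMap.zero_apply]

lemma homotopy_formula_zero (x : R ⊗[K] barSpace ε 0) :
    resDiff ε 0 (homotopy ε 0 x) + resAugLin ε x • (1 : R) ⊗ₜ unit ε = x := by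
  induction x using TensorProduct.induction_on with
  | zero => simp
  | add x y hx hy =>
    rw [map_add, map_add, map_add, add_smul, add_add_add_comm, hx, hy]
  | tmul r w =>
    rw [homotopy_tmul, map_neg, resDiff_tmul, diff_zero, consIncl_cons, TensorProduct.tmul_zero,
      zero_sub, neg_neg, one_smul, coe_proj, TensorProduct.sub_tmul, resAugLin_tmul, mul_smul,
      ← TensorProduct.tmul_smul (zeroEquiv ε w), ← eq_smul_unit, TensorProduct.smul_tmul',
      Algebra.algebraMap_eq_smul_one, sub_add_cancel]

variable (ε) in
/-- The bar resolution of `K` over `R`, as a complex. -/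
def resComplex : ChainComplex (ModuleCat.{u} R) ℕ :=
  ChainComplex.of (fun n => ModuleCat.of R (R ⊗[K] barSpace ε n))
    (fun n => ModuleCat.ofHom (resDiff ε n)) (fun n => by
      exact ModuleCat.hom_ext (LinearMap.ext fun x => resDiff_resDiff n x))

lemma resComplex_d (n : ℕ) : (resComplex ε).d (n + 1) n = ModuleCat.ofHom (resDiff ε n) :=
  ChainComplex.of_d (fun n => ModuleCat.of R (R ⊗[K] barSpace ε n))
    (fun n => ModuleCat.ofHom (resDiff ε n)) n

variable (ε) in
/-- The bar resolution of `K` over `R`. -/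
def resolution : ProjectiveResolution (residue ε) where
  complex := resComplex ε
  projective n := by
    change Projective (ModuleCat.of R (R ⊗[K] barSpace ε n))
    infer_instance
  π := (ChainComplex.toSingle₀Equiv _ _).symm
    ⟨ModuleCat.ofHom (X := R ⊗[K] barSpace ε 0) (Y := residue ε) (resAug ε), by
      rw [resComplex_d]
      exact ModuleCat.hom_ext (LinearMap.ext fun x => resAugLin_resDiff x)⟩
  quasiIso := ⟨fun n => by
    cases n with
    | zero =>
      rw [ChainComplex.quasiIsoAt₀_iff, ShortComplex.quasiIso_iff_of_zeros' _ rfl rfl rfl]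
      constructor
      · rw [ShortComplex.moduleCat_exact_iff]
        intro x hx
        have hx' : resAugLin ε x = 0 := hx
        refine ⟨(homotopy ε 0 x : R ⊗[K] barSpace ε 1), ?_⟩
        change (resComplex ε).d 1 0 _ = x
        rw [resComplex_d]
        have := homotopy_formula_zero (ε := ε) x
        rw [hx', zero_smul, add_zero] at this
        exact this
      · rw [ModuleCat.epi_iff_surjective]
        intro c
        change K at c
        refine ⟨(c • (1 : R) ⊗ₜ[K] unit ε : R ⊗[K] barSpace ε 0), ?_⟩
        change resAugLin ε _ = c
        rw [map_smul, resAugLin_tmul, map_one, zeroEquiv_unit]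
        rw [mul_one, smul_eq_mul, mul_one]
    | succ n =>
      rw [quasiIsoAt_iff_exactAt']
      · rw [HomologicalComplex.exactAt_iff' _ (n + 1 + 1) (n + 1) n (by simp) (by simp),
          ShortComplex.moduleCat_exact_iff]
        intro x hx
        have hx' : resDiff ε n x = 0 :=
          (ConcreteCategory.congr_hom (resComplex_d (ε := ε) n) x).symm.trans hx
        refine ⟨(homotopy ε (n + 1) x : R ⊗[K] barSpace ε (n + 2)), ?_⟩
        refine (ConcreteCategory.congr_hom (resComplex_d (ε := ε) (n + 1)) _).trans ?_
        have := homotopy_formula (ε := ε) n x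
        rw [hx', map_zero, add_zero] at this
        exact this
      · apply ChainComplex.exactAt_succ_single_obj⟩

lemma resolution_d (n : ℕ) :
    (resolution ε).complex.d (n + 1) n = ModuleCat.ofHom (resDiff ε n) :=
  resComplex_d n

section Functoriality

variable {σ : R ≃ₐ[K] R} (h : ∀ r, ε (σ r) = ε r)

/-- The restriction to `𝔪` of an automorphism of `R`. -/
def idealMap : RingHom.ker ε →ₗ[K] RingHom.ker ε where
  toFun a := ⟨σ a, (h a).trans a.2⟩
  map_add' a b := Subtype.ext (map_add σ (a : R) b)
  map_smul' c a := Subtype.ext (map_smul σ c (a : R))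

lemma coe_idealMap (a : RingHom.ker ε) : (idealMap h a : R) = σ a := rfl

lemma idealMap_smul (r : R) (a : RingHom.ker ε) : idealMap h (r • a) = σ r • idealMap h a :=
  Subtype.ext (map_mul σ r (a : R))

/-- The endomorphism of `𝔪^{⊗n}` induced by an automorphism of `R`. -/
def map : ∀ n, barSpace ε n →ₗ[K] barSpace ε n
  | 0 => LinearMap.id
  | n + 1 => consLift ((cons ε n).compl₁₂ (idealMap h) (map n))

lemma map_zero' (w : barSpace ε 0) : map h 0 w = w := rfl

lemma map_cons (n : ℕ) (a : RingHom.ker ε) (w : barSpace ε n) :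
    map h (n + 1) (cons ε n a w) = cons ε n (idealMap h a) (map h n w) :=
  consLift_cons _ _ _

lemma map_act (n : ℕ) (r : R) (w : barSpace ε n) :
    map h n (act ε n r w) = act ε n (σ r) (map h n w) := by
  cases n with
  | zero => rw [map_zero', map_zero', act_zero, act_zero, h]
  | succ n =>
    refine LinearMap.congr_fun (f := map h (n + 1) ∘ₗ act ε (n + 1) r)
      (g := act ε (n + 1) (σ r) ∘ₗ map h (n + 1)) (cons_ext fun a w => ?_) w
    rw [LinearMap.comp_apply, LinearMap.comp_apply, act_cons, map_cons, map_cons, act_cons,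
      idealMap_smul]

lemma map_diff (n : ℕ) (w : barSpace ε (n + 1)) :
    map h n (diff ε n w) = diff ε n (map h (n + 1) w) := by
  induction n with
  | zero => rw [diff_zero, diff_zero, _root_.map_zero]
  | succ n ih =>
    refine LinearMap.congr_fun (f := map h (n + 1) ∘ₗ diff ε (n + 1))
      (g := diff ε (n + 1) ∘ₗ map h (n + 2)) (cons_ext fun a w => ?_) w
    rw [LinearMap.comp_apply, LinearMap.comp_apply, map_cons, diff_cons, diff_cons, map_sub,
      map_act, map_cons, ih, coe_idealMap]

lemma map_consIncl (n : ℕ) (w : barSpace ε (n + 1)) :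
    TensorProduct.map σ.toLinearMap (map h n) (consIncl ε n w) =
      consIncl ε n (map h (n + 1) w) := by
  refine LinearMap.congr_fun (f := TensorProduct.map σ.toLinearMap (map h n) ∘ₗ consIncl ε n)
      (g := consIncl ε n ∘ₗ map h (n + 1)) (cons_ext fun a w => ?_) w
  rw [LinearMap.comp_apply, LinearMap.comp_apply, map_cons, consIncl_cons, consIncl_cons,
    TensorProduct.map_tmul]
  rfl

lemma tensor_map_smul (n : ℕ) (r : R) (x : R ⊗[K] barSpace ε n) :
    TensorProduct.map σ.toLinearMap (map h n) (r • x) =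
      σ r • TensorProduct.map σ.toLinearMap (map h n) x := by
  induction x using TensorProduct.induction_on with
  | zero => simp
  | add x y hx hy => rw [smul_add, map_add, hx, hy, map_add, smul_add]
  | tmul s w =>
    rw [TensorProduct.smul_tmul', TensorProduct.map_tmul, TensorProduct.map_tmul,
      TensorProduct.smul_tmul', smul_eq_mul, smul_eq_mul]
    exact congrArg (· ⊗ₜ _) (map_mul σ r s)

lemma map_resDiff (n : ℕ) (x : R ⊗[K] barSpace ε (n + 1)) :
    TensorProduct.map σ.toLinearMap (map h n) (resDiff ε n x) =
      resDiff ε n (TensorProduct.map σ.toLinearMap (map h (n + 1)) x) := by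
  induction x using TensorProduct.induction_on with
  | zero => simp
  | add x y hx hy => rw [map_add, map_add, hx, hy, map_add, map_add]
  | tmul r w =>
    rw [TensorProduct.map_tmul, resDiff_tmul, resDiff_tmul, map_sub, TensorProduct.map_tmul,
      tensor_map_smul, map_diff, map_consIncl]
    rfl

lemma resAugLin_map (x : R ⊗[K] barSpace ε 0) :
    resAugLin ε (TensorProduct.map σ.toLinearMap (map h 0) x) = resAugLin ε x := by
  induction x using TensorProduct.induction_on with
  | zero => simp
  | add x y hx hy => rw [map_add, map_add, hx, hy, map_add]
  | tmul r w =>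
    rw [TensorProduct.map_tmul, resAugLin_tmul, resAugLin_tmul, map_zero']
    exact congrArg (· * _) (h r)

/-- The semilinear lift of the identity of `K` to the bar resolution given by an automorphism
of `R`. -/
def resolutionLift : SemilinearLift ε (resolution ε) σ where
  map n :=
    { toFun := TensorProduct.map σ.toLinearMap (map h n)
      map_add' := map_add _
      map_smul' := tensor_map_smul h n }
  comm n x := by
    rw [resolution_d]
    exact map_resDiff h n x
  aug x := resAugLin_map h x

end Functoriality

variable (ε) in
/-- The element `1` of the `R`-module `K`. -/
def one : residue ε := (1 : K)

variable (ε) in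
/-- The map `w ↦ 1 ⊗ (1 ⊗ w)` from `𝔪^{⊗n}` to `K ⊗_R (R ⊗ 𝔪^{⊗n})`. -/
def toTensor (n : ℕ) : barSpace ε n →ₗ[K] (tensorComplex ε (resolution ε)).X n where
  toFun w := one ε ⊗ₜ[R] ((1 : R) ⊗ₜ[K] w : R ⊗[K] barSpace ε n)
  map_add' w w' := by
    rw [TensorProduct.tmul_add]
    exact TensorProduct.tmul_add _ _ _
  map_smul' c w := by
    change one ε ⊗ₜ[R] ((1 : R) ⊗ₜ[K] (c • w) : R ⊗[K] barSpace ε n) =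
      algebraMap K R c • (one ε ⊗ₜ[R] ((1 : R) ⊗ₜ[K] w : R ⊗[K] barSpace ε n))
    rw [← TensorProduct.tmul_smul, TensorProduct.tmul_smul c, ← algebraMap_smul R c]

variable (ε) in
/-- The map `r ⊗ w ↦ ε r • w`. -/
def specialize (n : ℕ) : R ⊗[K] barSpace ε n →ₗ[K] barSpace ε n :=
  TensorProduct.lift ((LinearMap.lsmul K (barSpace ε n)).comp ε.toLinearMap)

lemma specialize_tmul (n : ℕ) (r : R) (w : barSpace ε n) :
    specialize ε n (r ⊗ₜ w) = ε r • w := rfl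

lemma specialize_smul (n : ℕ) (r : R) (x : R ⊗[K] barSpace ε n) :
    specialize ε n (r • x) = ε r • specialize ε n x := by
  induction x using TensorProduct.induction_on with
  | zero => simp
  | add x y hx hy => rw [smul_add, map_add, hx, hy, map_add, smul_add]
  | tmul s w =>
    rw [TensorProduct.smul_tmul', specialize_tmul, specialize_tmul, smul_eq_mul, map_mul, mul_smul]

variable (ε) in
/-- The inverse `c ⊗ (r ⊗ w) ↦ c ε(r) w` of `toTensor`. -/
def ofTensor (n : ℕ) : residue ε ⊗[R] (R ⊗[K] barSpace ε n) →+ barSpace ε n :=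
  let f : K →+ R ⊗[K] barSpace ε n →+ barSpace ε n :=
    AddMonoidHom.mk' (fun c => (c • specialize ε n).toAddMonoidHom) (fun c c' => by
      ext x
      exact add_smul c c' _)
  TensorProduct.liftAddHom (M := residue ε) f (fun r c x => by
    change K at c
    change (ε r * c) • specialize ε n x = c • specialize ε n (r • x)
    rw [specialize_smul, smul_smul, mul_comm])

lemma toTensor_bijective (n : ℕ) : Function.Bijective (toTensor ε n) := by
  constructor
  · intro w w' hw
    have h : ∀ w, ofTensor ε n (toTensor ε n w) = w := fun w => by
      change (1 : K) • specialize ε n (1 ⊗ₜ w) = w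
      rw [one_smul, specialize_tmul, map_one, one_smul]
    rw [← h w, hw, h]
  · intro x
    change residue ε ⊗[R] (R ⊗[K] barSpace ε n) at x
    induction x using TensorProduct.induction_on with
    | zero => exact ⟨0, map_zero _⟩
    | add x y hx hy =>
      obtain ⟨w, hw⟩ := hx
      obtain ⟨w', hw'⟩ := hy
      refine ⟨w + w', (map_add (toTensor ε n) w w').trans ?_⟩
      rw [hw, hw']
      rfl
    | tmul c x =>
      induction x using TensorProduct.induction_on with
      | zero => exact ⟨0, (map_zero _).trans (TensorProduct.tmul_zero _ _).symm⟩
      | add x y hx hy =>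
        obtain ⟨w, hw⟩ := hx
        obtain ⟨w', hw'⟩ := hy
        refine ⟨w + w', (map_add (toTensor ε n) w w').trans ?_⟩
        rw [hw, hw']
        exact (TensorProduct.tmul_add _ _ _).symm
      | tmul r w =>
        change K at c
        refine ⟨(c * ε r) • w, ?_⟩
        change one ε ⊗ₜ[R] ((1 : R) ⊗ₜ[K] ((c * ε r) • w) : R ⊗[K] barSpace ε n) = _
        have h1 : (1 : R) ⊗ₜ[K] ((c * ε r) • w) = algebraMap K R (c * ε r) • ((1 : R) ⊗ₜ[K] w) := by
          rw [TensorProduct.tmul_smul, algebraMap_smul]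
        have h2 : r ⊗ₜ[K] w = r • ((1 : R) ⊗ₜ[K] w) := by
          rw [TensorProduct.smul_tmul', smul_eq_mul, mul_one]
        rw [h1, h2]
        refine (TensorProduct.smul_tmul _ _ _).symm.trans
          (Eq.trans ?_ (TensorProduct.smul_tmul _ _ _))
        congr 1
        change ε (algebraMap K R (c * ε r)) * (1 : K) = ε r * c
        rw [AlgHom.commutes, mul_one, mul_comm]
        rfl

/-- The elements of `𝔪` act as zero on `K`. -/
lemma one_tmul_consIncl (n : ℕ) (w : barSpace ε (n + 1)) :
    one ε ⊗ₜ[R] consIncl ε n w = 0 := by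
  have hw : w ∈ Submodule.span K {x | ∃ a w', cons ε n a w' = x} := by
    rw [span_cons]
    trivial
  induction hw using Submodule.span_induction with
  | mem x hx =>
    obtain ⟨a, w', rfl⟩ := hx
    have h2 : (a : R) ⊗ₜ[K] w' = (a : R) • ((1 : R) ⊗ₜ[K] w') := by
      rw [TensorProduct.smul_tmul', smul_eq_mul, mul_one]
    have h1 : (a : R) • one ε = 0 := by
      change ε a * (1 : K) = 0
      rw [show ε a = 0 from a.2, zero_mul]
    rw [consIncl_cons, h2, ← TensorProduct.smul_tmul, h1, TensorProduct.zero_tmul]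
  | zero => rw [map_zero, TensorProduct.tmul_zero]
  | add x y _ _ hx hy => rw [map_add, TensorProduct.tmul_add, hx, hy, add_zero]
  | smul c x _ hx =>
    rw [map_smul, ← algebraMap_smul R c, TensorProduct.tmul_smul, hx, smul_zero]

/-- The bar resolution becomes the complex `𝔪^{⊗n}` after tensoring with `K`. -/
lemma tensorComplex_d_toTensor (n : ℕ) (w : barSpace ε (n + 1)) :
    ((tensorComplex ε (resolution ε)).d (n + 1) n).hom (toTensor ε (n + 1) w) =
      toTensor ε n (diff ε n w) := by
  change one ε ⊗ₜ[R] (((resolution ε).complex.d (n + 1) n).hom _) = _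
  rw [resolution_d]
  change one ε ⊗ₜ[R] (resDiff ε n (1 ⊗ₜ w)) = one ε ⊗ₜ[R] (1 ⊗ₜ diff ε n w)
  rw [resDiff_tmul, TensorProduct.tmul_sub, one_smul, one_tmul_consIncl, sub_zero]

lemma chainMap_toTensor {σ : R ≃ₐ[K] R} (h : ∀ r, ε (σ r) = ε r) (n : ℕ) (w : barSpace ε n) :
    (((resolutionLift h).chainMap h).f n).hom (toTensor ε n w) = toTensor ε n (map h n w) := by
  change one ε ⊗ₜ[R] (σ 1 ⊗ₜ[K] map h n w) = one ε ⊗ₜ[R] (1 ⊗ₜ[K] map h n w)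
  rw [map_one]

end Bar
end AugTor

end

/-! ### Words in the bar complex of an algebra whose augmentation ideal has cube zero -/

noncomputable section

/-- The sequence `x, v 0, v 1, …`. -/
def Nat.prepend {α : Type*} (x : α) (v : ℕ → α) : ℕ → α
  | 0 => x
  | a + 1 => v a

/-- A set `T` of positions (given by its indicator function) fits `n` parts into `N` letters if
no two elements of `T` are adjacent, and cutting the word `0, …, N - 1` at all places except
between `t` and `t + 1` for `t ∈ T` yields `n` parts. All parts have then one or two letters.
Every position outside `T` ends a part, whence the equation `N = n + |T|`. -/
structure Fits (n N : ℕ) (T : ℕ → Bool) : Prop where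
  lt : ∀ a, T a = true → a + 1 < N
  sep : ∀ a, T a = true → T (a + 1) = false
  eq : N = n + Nat.count (fun a => T a = true) N

namespace Fits

variable {n N N' : ℕ} {T : ℕ → Bool}

lemma eq_zero (h : Fits 0 N T) : N = 0 := by
  cases N with
  | zero => rfl
  | succ N =>
    have h1 : T N = false := by
      by_contra h'
      have := h.lt N (by simpa using h')
      omega
    have h2 := h.eq
    rw [Nat.count_succ, h1] at h2
    have := Nat.count_le (p := fun a => T a = true) (n := N)
    simp at h2
    omega

lemma of_true (h : Fits (n + 1) N T) (h0 : T 0 = true) :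
    T 1 = false ∧ ∃ N', N = N' + 2 ∧ Fits n N' (fun a => T (a + 2)) := by
  have h1 := h.sep 0 h0
  have h2 := h.lt 0 h0
  refine ⟨h1, N - 2, by omega, fun a ha => ?_, fun a ha => h.sep _ ha, ?_⟩
  · have := h.lt _ ha
    omega
  · obtain ⟨N, rfl⟩ : ∃ N', N = N' + 2 := ⟨N - 2, by omega⟩
    have h3 := h.eq
    have hc : Nat.count (fun a => T a = true) (N + 2) =
        Nat.count (fun a => T (a + 2) = true) N + 1 := by
      rw [Nat.count_succ', Nat.count_succ']
      simp [h0, h1]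
    rw [hc] at h3
    simp only [Nat.add_sub_cancel]
    omega

lemma of_false (h : Fits (n + 1) N T) (h0 : T 0 = false) :
    ∃ N', N = N' + 1 ∧ Fits n N' (fun a => T (a + 1)) := by
  have h2 := h.eq
  refine ⟨N - 1, by omega, fun a ha => ?_, fun a ha => h.sep _ ha, ?_⟩
  · have := h.lt _ ha
    omega
  · obtain ⟨N, rfl⟩ : ∃ N', N = N' + 1 := ⟨N - 1, by omega⟩
    have h3 := h.eq
    have hc : Nat.count (fun a => T a = true) (N + 1) =
        Nat.count (fun a => T (a + 1) = true) N := by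
      rw [Nat.count_succ']
      simp [h0]
    rw [hc] at h3
    simp only [Nat.add_sub_cancel]
    omega

lemma zero : Fits 0 0 (fun _ => false) where
  lt _ h := by simp at h
  sep _ h := by simp at h
  eq := by simp

lemma prepend_false (h : Fits n N T) : Fits (n + 1) (N + 1) (Nat.prepend false T) where
  lt a ha := by
    cases a with
    | zero => simp [Nat.prepend] at ha
    | succ a => have := h.lt a ha; omega
  sep a ha := by
    cases a with
    | zero => simp [Nat.prepend] at ha
    | succ a => exact h.sep a ha
  eq := by
    have hc : Nat.count (fun a => Nat.prepend false T a = true) (N + 1) =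
        Nat.count (fun a => T a = true) N := by
      rw [Nat.count_succ']
      simp [Nat.prepend]
      congr!
    have := h.eq
    omega

lemma prepend_true (h : Fits n N T) :
    Fits (n + 1) (N + 2) (Nat.prepend true (Nat.prepend false T)) where
  lt a ha := by
    match a with
    | 0 => omega
    | 1 => simp [Nat.prepend] at ha
    | a + 2 => have := h.lt a ha; omega
  sep a ha := by
    match a with
    | 0 => rfl
    | 1 => simp [Nat.prepend] at ha
    | a + 2 => exact h.sep a ha
  eq := by
    have hc : Nat.count (fun a => Nat.prepend true (Nat.prepend false T) a = true) (N + 2) =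
        Nat.count (fun a => T a = true) N + 1 := by
      rw [Nat.count_succ', Nat.count_succ']
      simp [Nat.prepend]
      congr!
    have := h.eq
    omega

lemma unique (h : Fits n N T) (h' : Fits n N' T) : N = N' := by
  induction n generalizing N N' T with
  | zero => rw [h.eq_zero, h'.eq_zero]
  | succ n ih =>
    cases h0 : T 0 with
    | true =>
      obtain ⟨-, N, rfl, hS⟩ := h.of_true h0
      obtain ⟨-, N', rfl, hS'⟩ := h'.of_true h0
      rw [ih hS hS']
    | false =>
      obtain ⟨N, rfl, hS⟩ := h.of_false h0
      obtain ⟨N', rfl, hS'⟩ := h'.of_false h0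
      rw [ih hS hS']

lemma le_two_mul (h : Fits n N T) : N ≤ 2 * n := by
  induction n generalizing N T with
  | zero => rw [h.eq_zero]
  | succ n ih =>
    cases h0 : T 0 with
    | true =>
      obtain ⟨-, N, rfl, hS⟩ := h.of_true h0
      have := ih hS
      omega
    | false =>
      obtain ⟨N, rfl, hS⟩ := h.of_false h0
      have := ih hS
      omega

end Fits

namespace AugTor

universe u
variable {K R : Type u} [Field K] [CommRing R] [Algebra K R]

/-- Data identifying the augmented algebra `R` with `K ⊕ V ⊕ Sym² V` for the vector space `V = K^X`,
where `X` is finite and `K` has characteristic zero: the inclusion `ι` of `V` into the augmentation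
ideal `𝔪`, and the coordinates `lin x` and `quad x y` of the components of an element of `𝔪` in `V`
and in `Sym² V`. The product of the basis vectors `x` and `y` has the coordinate `1` in `Sym² V`,
or `2` if `x = y`, as for second derivatives. -/
structure CubeZero (ε : R →ₐ[K] K) (X : Type) where
  ι : (X → K) →ₗ[K] RingHom.ker ε
  lin : X → RingHom.ker ε →ₗ[K] K
  quad : X → X → RingHom.ker ε →ₗ[K] K
  cube : ∀ a b c : RingHom.ker ε, (a * b * c : R) = 0
  span : ∀ a : RingHom.ker ε, a ∈ Submodule.span K
    (Set.range ι ∪ {a | ∃ v w, a = (ι v : R) • ι w})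
  lin_ι : ∀ x v, lin x (ι v) = v x
  lin_mul : ∀ x v w, lin x ((ι v : R) • ι w) = 0
  quad_ι : ∀ x y v, quad x y (ι v) = 0
  quad_mul : ∀ x y v w, quad x y ((ι v : R) • ι w) = v x * w y + v y * w x

namespace CubeZero
open Bar

variable {ε : R →ₐ[K] K} {X : Type} (S : CubeZero ε X)

/-- The product `V × V → 𝔪`. -/
def mul : (X → K) →ₗ[K] (X → K) →ₗ[K] RingHom.ker ε :=
  ((Algebra.lsmul K K (RingHom.ker ε)).toLinearMap ∘ₗ incl ε ∘ₗ S.ι).compl₂ S.ι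

lemma mul_apply (v w : X → K) : S.mul v w = (S.ι v : R) • S.ι w := rfl

lemma mul_comm (v w : X → K) : S.mul v w = S.mul w v :=
  Subtype.ext (_root_.mul_comm (S.ι v : R) (S.ι w))

lemma smul_smul_eq_zero (S : CubeZero ε X) (a b c : RingHom.ker ε) :
    (a : R) • (b : R) • c = 0 := by
  apply Subtype.ext
  have := S.cube a b c
  rw [mul_assoc] at this
  exact this

/-- The element of the bar complex obtained from the letters `v 0, v 1, …` by multiplying the
letters `t` and `t + 1` for all `t ∈ T`. The letters form an infinite sequence, of which only an
initial segment matters. -/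
def word : ∀ n, (ℕ → Bool) → (ℕ → X → K) → barSpace ε n
  | 0, _, _ => unit ε
  | n + 1, T, v =>
    if T 0 = true then
      cons ε n (S.mul (v 0) (v 1)) (word n (fun a => T (a + 2)) (fun a => v (a + 2)))
    else cons ε n (S.ι (v 0)) (word n (fun a => T (a + 1)) (fun a => v (a + 1)))

lemma word_true (n : ℕ) (T : ℕ → Bool) (v : ℕ → X → K) (h : T 0 = true) :
    S.word (n + 1) T v =
      cons ε n (S.mul (v 0) (v 1)) (S.word n (fun a => T (a + 2)) (fun a => v (a + 2))) := by
  rw [word, if_pos h]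

lemma word_false (n : ℕ) (T : ℕ → Bool) (v : ℕ → X → K) (h : T 0 = false) :
    S.word (n + 1) T v =
      cons ε n (S.ι (v 0)) (S.word n (fun a => T (a + 1)) (fun a => v (a + 1))) := by
  rw [word, if_neg (by simp [h])]

/-- A word is linear in each of its letters. -/
lemma exists_word_update (n : ℕ) {N : ℕ} {T : ℕ → Bool} (hT : Fits n N T) (v : ℕ → X → K) {j : ℕ}
    (hj : j < N) :
    ∃ L : (X → K) →ₗ[K] barSpace ε n, ∀ x, S.word n T (Function.update v j x) = L x := by
  induction n generalizing N T v j with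
  | zero =>
    have := hT.eq_zero
    omega
  | succ n ih =>
    cases h0 : T 0 with
    | true =>
      obtain ⟨-, N, rfl, hT'⟩ := hT.of_true h0
      match j with
      | 0 =>
        refine ⟨(cons ε n).flip
          (S.word n (fun a => T (a + 2)) (fun a => v (a + 2))) ∘ₗ S.mul.flip (v 1),
          fun x => ?_⟩
        rw [word_true _ _ _ _ h0]
        rfl
      | 1 =>
        refine ⟨(cons ε n).flip
          (S.word n (fun a => T (a + 2)) (fun a => v (a + 2))) ∘ₗ S.mul (v 0),
          fun x => ?_⟩
        rw [word_true _ _ _ _ h0]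
        rfl
      | j + 2 =>
        obtain ⟨L, hL⟩ := ih hT' (fun a => v (a + 2)) (j := j) (by omega)
        refine ⟨cons ε n (S.mul (v 0) (v 1)) ∘ₗ L, fun x => ?_⟩
        rw [word_true _ _ _ _ h0, LinearMap.comp_apply, ← hL]
        congr 2
        ext a : 1
        simp [Function.update_apply]
    | false =>
      obtain ⟨N, rfl, hT'⟩ := hT.of_false h0
      match j with
      | 0 =>
        refine ⟨(cons ε n).flip (S.word n (fun a => T (a + 1)) (fun a => v (a + 1))) ∘ₗ S.ι,
          fun x => ?_⟩
        rw [word_false _ _ _ _ h0]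
        rfl
      | j + 1 =>
        obtain ⟨L, hL⟩ := ih hT' (fun a => v (a + 1)) (j := j) (by omega)
        refine ⟨cons ε n (S.ι (v 0)) ∘ₗ L, fun x => ?_⟩
        rw [word_false _ _ _ _ h0, LinearMap.comp_apply, ← hL]
        congr 2
        ext a : 1
        simp [Function.update_apply]

/-- A word of `N` letters does not depend on the letters beyond the first `N`. -/
lemma word_congr (n : ℕ) {N : ℕ} {T : ℕ → Bool} (hT : Fits n N T) {v v' : ℕ → X → K}
    (h : ∀ a < N, v a = v' a) : S.word n T v = S.word n T v' := by
  induction n generalizing N T v v' with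
  | zero => rfl
  | succ n ih =>
    cases h0 : T 0 with
    | true =>
      obtain ⟨-, N, rfl, hS⟩ := hT.of_true h0
      rw [word_true _ _ _ _ h0, word_true _ _ _ _ h0, h 0 (by omega), h 1 (by omega),
        ih hS fun a ha => h (a + 2) (by omega)]
    | false =>
      obtain ⟨N, rfl, hS⟩ := hT.of_false h0
      rw [word_false _ _ _ _ h0, word_false _ _ _ _ h0, h 0 (by omega),
        ih hS fun a ha => h (a + 1) (by omega)]

lemma swap_add (s t c a : ℕ) :
    Equiv.swap (s + c) (t + c) (a + c) = Equiv.swap s t a + c := by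
  simp only [Equiv.swap_apply_def, Nat.add_right_cancel_iff]
  split_ifs <;> rfl

/-- Exchanging two letters that are multiplied does not change a word. -/
lemma word_swap (n : ℕ) {T : ℕ → Bool} (hT : ∀ a, T a = true → T (a + 1) = false)
    (v : ℕ → X → K) {t : ℕ} (ht : T t = true) :
    S.word n T (v ∘ Equiv.swap t (t + 1)) = S.word n T v := by
  induction n generalizing T v t with
  | zero => rfl
  | succ n ih =>
    cases h0 : T 0 with
    | true =>
      rw [word_true _ _ _ _ h0, word_true _ _ _ _ h0]
      match t with
      | 0 =>
        congr 1
        exact congrArg _ (S.mul_comm _ _)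
      | 1 =>
        have := hT 0 h0
        simp [ht] at this
      | t + 2 =>
        congr 1
        rw [← ih (T := fun a => T (a + 2)) (fun a => hT _) (fun a => v (a + 2)) ht]
        congr 1
        funext a
        exact congrArg v (swap_add t (t + 1) 2 a)
    | false =>
      rw [word_false _ _ _ _ h0, word_false _ _ _ _ h0]
      match t with
      | 0 => simp [ht] at h0
      | t + 1 =>
        congr 1
        rw [← ih (T := fun a => T (a + 1)) (fun a => hT _) (fun a => v (a + 1)) ht]
        congr 1
        funext a
        exact congrArg v (swap_add t (t + 1) 1 a)

lemma map_word {σ : R ≃ₐ[K] R} (h : ∀ r, ε (σ r) = ε r) (g : (X → K) →ₗ[K] (X → K))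
    (hg : ∀ v, idealMap h (S.ι v) = S.ι (g v)) (n : ℕ) (T : ℕ → Bool) (v : ℕ → X → K) :
    map h n (S.word n T v) = S.word n T (fun a => g (v a)) := by
  induction n generalizing T v with
  | zero => rfl
  | succ n ih =>
    cases h0 : T 0 with
    | true =>
      rw [word_true _ _ _ _ h0, word_true _ _ _ _ h0, map_cons, ih, mul_apply, idealMap_smul,
        mul_apply, ← hg, ← hg]
      rfl
    | false =>
      rw [word_false _ _ _ _ h0, word_false _ _ _ _ h0, map_cons, ih, hg]

/-- An element `s` can be added to the set `T` if neither `s` nor its neighbours are in `T`. -/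
def Free (T : ℕ → Bool) (s : ℕ) : Prop :=
  T s = false ∧ T (s + 1) = false ∧ ∀ r, s = r + 1 → T r = false

open scoped Classical in
/-- The differential of the bar complex in terms of words: it multiplies the letters `s` and `s + 1`
for each `s` that can be added to `T`. The other products vanish, having at least three factors
in `𝔪`. The sign is that of the number of parts before the letter `s`, modulo `2`. -/
lemma diff_word (n : ℕ) {N : ℕ} {T : ℕ → Bool} (hT : Fits (n + 1) N T) (v : ℕ → X → K) :
    diff ε n (S.word (n + 1) T v) = ∑ s ∈ Finset.range (N - 1), if Free T s then
      (-1 : K) ^ (s + Nat.count (fun a => T a = true) s) •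
        S.word n (Function.update T s true) v else 0 := by
  induction n generalizing N T v with
  | zero =>
    rw [diff_zero]
    symm
    refine Finset.sum_eq_zero fun s hs => if_neg fun hf => ?_
    cases h0 : T 0 with
    | true =>
      obtain ⟨-, N, rfl, hT'⟩ := hT.of_true h0
      obtain rfl := hT'.eq_zero
      simp at hs
      subst hs
      simp [Free, h0] at hf
    | false =>
      obtain ⟨N, rfl, hT'⟩ := hT.of_false h0
      obtain rfl := hT'.eq_zero
      simp at hs
  | succ n ih =>
    cases h0 : T 0 with
    | true =>
      obtain ⟨h1, N, rfl, hT'⟩ := hT.of_true h0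
      obtain ⟨N, rfl⟩ : ∃ N', N = N' + 1 := ⟨N - 1, by have := hT'.eq; omega⟩
      rw [word_true _ _ _ _ h0, diff_cons, ih hT']
      -- The first part has two letters already, so its product with the second part is zero.
      have hz : act ε (n + 1) (S.mul (v 0) (v 1) : R)
          (S.word (n + 1) (fun a => T (a + 2)) (fun a => v (a + 2))) = 0 := by
        have : ∀ b : RingHom.ker ε, (S.mul (v 0) (v 1) : R) • b = 0 := fun b => by
          rw [mul_apply, show ((((S.ι (v 0) : R) • S.ι (v 1) : RingHom.ker ε) : R) =
            (S.ι (v 0) : R) * (S.ι (v 1) : R)) from rfl, mul_smul, S.smul_smul_eq_zero]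
        rw [word]
        split_ifs <;> rw [act_cons, this, map_zero, LinearMap.zero_apply]
      rw [hz, zero_sub, map_sum, ← Finset.sum_neg_distrib]
      have hN : N + 1 + 2 - 1 = N + 1 + 1 := rfl
      rw [hN, Finset.sum_range_succ', Finset.sum_range_succ', Nat.add_sub_cancel]
      rw [if_neg (fun hf => by simpa [h0] using hf.2.2 0 rfl),
        if_neg (fun hf => by simpa [h0] using hf.1), add_zero, add_zero]
      refine Finset.sum_congr rfl fun s _ => ?_
      have hfree : Free T (s + 1 + 1) ↔ Free (fun a => T (a + 2)) s := by
        refine and_congr Iff.rfl (and_congr Iff.rfl ⟨fun h r hr => ?_, fun h r hr => ?_⟩)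
        · subst hr
          exact h (r + 2) rfl
        · obtain rfl : r = s + 1 := by omega
          cases s with
          | zero => exact h1
          | succ s => exact h s rfl
      simp only [hfree]
      split_ifs with hf
      · have hc : Nat.count (fun a => T a = true) (s + 1 + 1) =
            Nat.count (fun a => T (a + 2) = true) s + 1 := by
          rw [Nat.count_succ', Nat.count_succ']
          simp [h0, h1]
        rw [word_true _ _ _ _ (by simp [h0]), hc, map_smul, ← neg_smul]
        congr 1
        · ring
        · congr 2
          ext a : 1
          simp [Function.update_apply]
      · rw [map_zero, neg_zero]
    | false =>
      obtain ⟨N, rfl, hT'⟩ := hT.of_false h0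
      obtain ⟨N, rfl⟩ : ∃ N', N = N' + 1 := ⟨N - 1, by have := hT'.eq; omega⟩
      rw [word_false _ _ _ _ h0, diff_cons, ih hT', Nat.add_sub_cancel, Nat.add_sub_cancel,
        Finset.sum_range_succ', sub_eq_neg_add, map_sum, ← Finset.sum_neg_distrib]
      congr 1
      · refine Finset.sum_congr rfl fun s _ => ?_
        have hfree : Free T (s + 1) ↔ Free (fun a => T (a + 1)) s := by
          refine and_congr Iff.rfl (and_congr Iff.rfl ⟨fun h r hr => ?_, fun h r hr => ?_⟩)
          · subst hr
            exact h (r + 1) rfl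
          · obtain rfl : r = s := by omega
            cases r with
            | zero => exact h0
            | succ s => exact h s rfl
        simp only [hfree]
        split_ifs with hf
        · have hc : Nat.count (fun a => T a = true) (s + 1) =
              Nat.count (fun a => T (a + 1) = true) s := by
            rw [Nat.count_succ']
            simp [h0]
          rw [word_false _ _ _ _ (by simp [h0]), hc, map_smul, ← neg_smul]
          congr 1
          · ring
          · congr 2
            ext a : 1
            simp [Function.update_apply]
        · rw [map_zero, neg_zero]
      -- The term `s = 0` multiplies the first letter by the second part, which is zero unless that
      -- part consists of one letter.
      · cases h1 : T 1 with
        | true =>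
          rw [if_neg (fun hf => by simpa [h1] using hf.2.1), word_true _ _ _ _ h1, act_cons,
            mul_apply, S.smul_smul_eq_zero, map_zero, LinearMap.zero_apply]
        | false =>
          rw [if_pos ⟨h0, h1, fun r hr => by omega⟩, word_false _ _ _ _ h1, act_cons,
            word_true _ _ _ _ (by simp)]
          simp [mul_apply]

/-- The words span the bar complex. -/
lemma span_word (n : ℕ) :
    Submodule.span K {w | ∃ N T v, Fits n N T ∧ S.word n T v = w} = ⊤ := by
  induction n with
  | zero =>
    rw [eq_top_iff]
    rintro w -
    rw [eq_smul_unit ε w]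
    exact Submodule.smul_mem _ _ (Submodule.subset_span ⟨0, _, fun _ => 0, Fits.zero, rfl⟩)
  | succ n ih =>
    rw [eq_top_iff, ← span_cons, Submodule.span_le]
    rintro _ ⟨a, w, rfl⟩
    have hw : w ∈ Submodule.span K {w | ∃ N T v, Fits n N T ∧ S.word n T v = w} := by
      rw [ih]
      trivial
    have ha := S.span a
    rw [SetLike.mem_coe]
    induction ha using Submodule.span_induction with
    | zero => rw [map_zero, LinearMap.zero_apply]; exact Submodule.zero_mem _
    | add x y _ _ hx hy => rw [map_add, LinearMap.add_apply]; exact Submodule.add_mem _ hx hy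
    | smul c x _ hx => rw [map_smul, LinearMap.smul_apply]; exact Submodule.smul_mem _ _ hx
    | mem a ha =>
      induction hw using Submodule.span_induction with
      | zero => rw [map_zero]; exact Submodule.zero_mem _
      | add x y _ _ hx hy => rw [map_add]; exact Submodule.add_mem _ hx hy
      | smul c x _ hx => rw [map_smul]; exact Submodule.smul_mem _ _ hx
      | mem w hw =>
        obtain ⟨N, T, v, hT, rfl⟩ := hw
        apply Submodule.subset_span
        rcases ha with ⟨x, rfl⟩ | ⟨x, y, rfl⟩
        · refine ⟨_, _, Nat.prepend x v, hT.prepend_false, ?_⟩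
          rw [word_false _ _ _ _ rfl]
          rfl
        · refine ⟨_, _, Nat.prepend x (Nat.prepend y v), hT.prepend_true, ?_⟩
          rw [word_true _ _ _ _ rfl]
          rfl

/-- The coordinate function on `𝔪^{⊗n}` for the pattern `T` and the indices `y`: the tensor product
of the functionals `lin (y a)` for parts with one letter `a` and `quad (y a) (y (a + 1))` for parts
with two letters `a` and `a + 1`. -/
def coord : ∀ n, (ℕ → Bool) → (ℕ → X) → barSpace ε n →ₗ[K] K
  | 0, _, _ => (zeroEquiv ε).toLinearMap
  | n + 1, T, y =>
    if T 0 = true then consLift ((S.quad (y 0) (y 1)).smulRight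
      (coord n (fun a => T (a + 2)) (fun a => y (a + 2))))
    else consLift ((S.lin (y 0)).smulRight (coord n (fun a => T (a + 1)) (fun a => y (a + 1))))

lemma coord_true (n : ℕ) (T : ℕ → Bool) (y : ℕ → X) (h : T 0 = true) (a : RingHom.ker ε)
    (w : barSpace ε n) : S.coord (n + 1) T y (cons ε n a w) =
      S.quad (y 0) (y 1) a * S.coord n (fun a => T (a + 2)) (fun a => y (a + 2)) w := by
  rw [coord, if_pos h, consLift_cons]
  rfl

lemma coord_false (n : ℕ) (T : ℕ → Bool) (y : ℕ → X) (h : T 0 = false) (a : RingHom.ker ε)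
    (w : barSpace ε n) : S.coord (n + 1) T y (cons ε n a w) =
      S.lin (y 0) a * S.coord n (fun a => T (a + 1)) (fun a => y (a + 1)) w := by
  rw [coord, if_neg (by simp [h]), consLift_cons]
  rfl

/-- The coordinate functions for one pattern vanish on the words for all others. -/
lemma eq_of_coord_word_ne_zero (n : ℕ) {N N' : ℕ} {T T' : ℕ → Bool} (hT : Fits n N T)
    (hT' : Fits n N' T') (y : ℕ → X) (v : ℕ → X → K) (h : S.coord n T y (S.word n T' v) ≠ 0) :
    T = T' := by
  induction n generalizing N N' T T' y v with
  | zero =>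
    obtain rfl := hT.eq_zero
    obtain rfl := hT'.eq_zero
    funext a
    have h1 := hT.lt a
    have h2 := hT'.lt a
    simp at h1 h2
    rw [h1, h2]
  | succ n ih =>
    cases h0 : T 0 with
    | true =>
      obtain ⟨h1, N, rfl, hS⟩ := hT.of_true h0
      cases h0' : T' 0 with
      | true =>
        obtain ⟨h1', N', rfl, hS'⟩ := hT'.of_true h0'
        rw [word_true _ _ _ _ h0', coord_true _ _ _ _ h0] at h
        have := ih hS hS' _ _ (right_ne_zero_of_mul h)
        funext a
        match a with
        | 0 => rw [h0, h0']
        | 1 => rw [h1, h1']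
        | a + 2 => exact congrFun this a
      | false =>
        rw [word_false _ _ _ _ h0', coord_true _ _ _ _ h0, S.quad_ι, zero_mul] at h
        exact absurd rfl h
    | false =>
      obtain ⟨N, rfl, hS⟩ := hT.of_false h0
      cases h0' : T' 0 with
      | true =>
        rw [word_true _ _ _ _ h0', coord_false _ _ _ _ h0, mul_apply, S.lin_mul, zero_mul] at h
        exact absurd rfl h
      | false =>
        obtain ⟨N', rfl, hS'⟩ := hT'.of_false h0'
        rw [word_false _ _ _ _ h0', coord_false _ _ _ _ h0] at h
        have := ih hS hS' _ _ (right_ne_zero_of_mul h)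
        funext a
        match a with
        | 0 => rw [h0, h0']
        | a + 1 => exact congrFun this a

/-- The letter `1` is the sum of all basis vectors, so that all coordinates of the word with this
letter only are products of the numbers `1` and `2`. -/
lemma coord_word_one_ne_zero [CharZero K] (n : ℕ) (T : ℕ → Bool) (y : ℕ → X) :
    S.coord n T y (S.word n T fun _ => 1) ≠ 0 := by
  induction n generalizing T y with
  | zero =>
    change zeroEquiv ε (unit ε) ≠ 0
    rw [zeroEquiv_unit]
    exact one_ne_zero
  | succ n ih =>
    cases h0 : T 0 with
    | true =>
      rw [word_true _ _ _ _ h0, coord_true _ _ _ _ h0, mul_apply, S.quad_mul]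
      refine mul_ne_zero ?_ (ih _ _)
      simp only [Pi.one_apply, mul_one]
      norm_num
    | false =>
      rw [word_false _ _ _ _ h0, coord_false _ _ _ _ h0, S.lin_ι]
      exact mul_ne_zero one_ne_zero (ih _ _)

/-- A coordinate `y` of a word in basis vectors `x` can only be nonzero if `x` and `y` agree up
to exchanging letters that are multiplied. This is expressed by means of the functions `C` of `N`
letters that are invariant under these exchanges. -/
lemma eq_of_coord_word_single_ne_zero [DecidableEq X] {Z : Type*} (n : ℕ) {N : ℕ} {T : ℕ → Bool}
    (hT : Fits n N T) (x y : ℕ → X) (C : (ℕ → X) → Z)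
    (h1 : ∀ z z', (∀ a < N, z a = z' a) → C z = C z')
    (h2 : ∀ t, T t = true → ∀ z, C (z ∘ Equiv.swap t (t + 1)) = C z)
    (h : S.coord n T y (S.word n T fun a => Pi.single (x a) 1) ≠ 0) : C x = C y := by
  induction n generalizing N T x y C with
  | zero =>
    obtain rfl := hT.eq_zero
    exact h1 _ _ (fun a ha => absurd ha (Nat.not_lt_zero a))
  | succ n ih =>
    cases h0 : T 0 with
    | true =>
      obtain ⟨-, N, rfl, hS⟩ := hT.of_true h0
      rw [word_true _ _ _ _ h0, coord_true _ _ _ _ h0, mul_apply, S.quad_mul] at h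
      have key := ih hS (fun a => x (a + 2)) (fun a => y (a + 2))
        (fun z => C (Nat.prepend (x 0) (Nat.prepend (x 1) z)))
        (fun z z' hz => h1 _ _ (fun a ha => by
          match a with
          | 0 => rfl
          | 1 => rfl
          | a + 2 => exact hz a (by omega)))
        (fun t ht z => by
          refine Eq.trans ?_ (h2 (t + 2) ht _)
          congr 1
          funext a
          match a with
          | 0 => simp [Nat.prepend, Equiv.swap_apply_def]
          | 1 => simp [Nat.prepend, Equiv.swap_apply_def]
          | a + 2 =>
            simp only [Function.comp_apply]
            rw [show t + 2 + 1 = t + 1 + 2 from rfl, swap_add]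
            rfl)
        (right_ne_zero_of_mul h)
      have hx : C x = C (Nat.prepend (x 0) (Nat.prepend (x 1) fun a => x (a + 2))) :=
        h1 _ _ fun a _ => by match a with | 0 => rfl | 1 => rfl | a + 2 => rfl
      rw [hx, key]
      have h3 := left_ne_zero_of_mul h
      by_cases hxy : y 0 = x 0 ∧ y 1 = x 1
      · exact h1 _ _ fun a _ => by
          match a with | 0 => exact hxy.1.symm | 1 => exact hxy.2.symm | a + 2 => rfl
      · have hxy' : y 1 = x 0 ∧ y 0 = x 1 := by
          by_contra h4
          apply h3
          simp only [Pi.single_apply]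
          rw [not_and_or] at hxy h4
          rcases hxy with h5 | h5 <;> rcases h4 with h6 | h6 <;> simp [h5, h6]
        rw [← h2 0 h0]
        exact h1 _ _ fun a _ => by
          match a with
          | 0 => simp [Nat.prepend, hxy'.2]
          | 1 => simp [Nat.prepend, hxy'.1]
          | a + 2 => simp [Nat.prepend, Equiv.swap_apply_def]
    | false =>
      obtain ⟨N, rfl, hS⟩ := hT.of_false h0
      rw [word_false _ _ _ _ h0, coord_false _ _ _ _ h0, S.lin_ι] at h
      have key := ih hS (fun a => x (a + 1)) (fun a => y (a + 1))
        (fun z => C (Nat.prepend (x 0) z))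
        (fun z z' hz => h1 _ _ (fun a ha => by
          match a with
          | 0 => rfl
          | a + 1 => exact hz a (by omega)))
        (fun t ht z => by
          refine Eq.trans ?_ (h2 (t + 1) ht _)
          congr 1
          funext a
          match a with
          | 0 => simp [Nat.prepend, Equiv.swap_apply_def]
          | a + 1 =>
            simp only [Function.comp_apply]
            rw [swap_add]
            rfl)
        (right_ne_zero_of_mul h)
      have hx : C x = C (Nat.prepend (x 0) fun a => x (a + 1)) :=
        h1 _ _ fun a _ => by match a with | 0 => rfl | a + 1 => rfl
      rw [hx, key]
      have h3 := left_ne_zero_of_mul h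
      have hxy : y 0 = x 0 := by
        by_contra h4
        exact h3 (Pi.single_eq_of_ne h4 _)
      exact h1 _ _ fun a _ => by
        match a with | 0 => exact hxy.symm | a + 1 => rfl

end CubeZero
end AugTor

end

/-! ### The ring of polynomials modulo the cube of the maximal ideal -/

noncomputable section

namespace FatPoint
open MvPolynomial

variable {m : ℕ}

/-- The quotient map from polynomials, as a homomorphism of algebras. -/
abbrev quot (m : ℕ) : MvPolynomial (Fin m) ℂ →ₐ[ℂ] FatRing m :=
  Ideal.Quotient.mkₐ ℂ ((idealOfVars (Fin m) ℂ) ^ 3)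

lemma augmentation_quot (p : MvPolynomial (Fin m) ℂ) :
    augmentation m (quot m p) = constantCoeff p := by
  have : (augmentation m).comp (quot m) = aeval fun _ => (0 : ℂ) :=
    MvPolynomial.algHom_ext fun j => by
      rw [AlgHom.comp_apply, aeval_X]
      exact augmentation_X m j
  refine (DFunLike.congr_fun this p).trans ?_
  simp [aeval_zero']

lemma mem_idealOfVars_iff (p : MvPolynomial (Fin m) ℂ) :
    p ∈ idealOfVars (Fin m) ℂ ↔ constantCoeff p = 0 := by
  have := mem_pow_idealOfVars_iff' 1 p
  rw [pow_one] at this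
  rw [this]
  constructor
  · intro h
    exact h 0 (by simp)
  · intro h x hx
    obtain rfl : x = 0 := by simpa [Finsupp.degree_eq_zero_iff] using hx
    exact h

lemma mul_mul_eq_zero (a b c : FatRing m) (ha : augmentation m a = 0) (hb : augmentation m b = 0)
    (hc : augmentation m c = 0) : a * b * c = 0 := by
  obtain ⟨p, rfl⟩ := Ideal.Quotient.mkₐ_surjective ℂ _ a
  obtain ⟨q, rfl⟩ := Ideal.Quotient.mkₐ_surjective ℂ _ b
  obtain ⟨r, rfl⟩ := Ideal.Quotient.mkₐ_surjective ℂ _ c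
  rw [augmentation_quot, ← mem_idealOfVars_iff] at ha hb hc
  rw [← map_mul, ← map_mul]
  refine Ideal.Quotient.eq_zero_iff_mem.2 ?_
  rw [pow_succ, pow_two]
  exact Ideal.mul_mem_mul (Ideal.mul_mem_mul ha hb) hc

/-- The linear form with given coefficients. -/
def linearForm (m : ℕ) : (Fin m → ℂ) →ₗ[ℂ] MvPolynomial (Fin m) ℂ :=
  Fintype.linearCombination ℂ X

lemma linearForm_apply (v : Fin m → ℂ) : linearForm m v = ∑ i, v i • X i := rfl

lemma constantCoeff_linearForm (v : Fin m → ℂ) : constantCoeff (linearForm m v) = 0 := by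
  simp [linearForm_apply]

lemma pderiv_linearForm (x : Fin m) (v : Fin m → ℂ) : pderiv x (linearForm m v) = C (v x) := by
  simp [linearForm_apply, pderiv_X, Pi.single_apply, smul_eq_C_mul]

lemma pderiv_mem {k : ℕ} {p : MvPolynomial (Fin m) ℂ} (hp : p ∈ idealOfVars (Fin m) ℂ ^ (k + 1))
    (x : Fin m) : pderiv x p ∈ idealOfVars (Fin m) ℂ ^ k := by
  induction k generalizing p with
  | zero => simp
  | succ k ih =>
    rw [pow_succ] at hp
    induction hp using Submodule.mul_induction_on' with
    | mem_mul_mem a ha b hb =>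
      rw [Derivation.leibniz, smul_eq_mul, smul_eq_mul]
      refine Ideal.add_mem _ (Ideal.mul_mem_right _ _ ha) ?_
      rw [pow_succ, mul_comm]
      exact Ideal.mul_mem_mul hb (ih ha)
    | add a _ b _ ha hb => rw [map_add]; exact Ideal.add_mem _ ha hb

/-- The linear functional on the quotient induced by a linear functional on polynomials that
vanishes on the cube of the maximal ideal. -/
def descend (f : MvPolynomial (Fin m) ℂ →ₗ[ℂ] ℂ) (hf : ∀ p ∈ idealOfVars (Fin m) ℂ ^ 3, f p = 0) :
    FatRing m →ₗ[ℂ] ℂ :=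
  Submodule.liftQ ((idealOfVars (Fin m) ℂ ^ 3).restrictScalars ℂ) f
      (fun p hp => hf p ((Submodule.restrictScalars_mem ℂ _ p).1 hp)) ∘ₗ
    (Submodule.Quotient.restrictScalarsEquiv ℂ (idealOfVars (Fin m) ℂ ^ 3)).symm.toLinearMap

lemma descend_quot (f : MvPolynomial (Fin m) ℂ →ₗ[ℂ] ℂ)
    (hf : ∀ p ∈ idealOfVars (Fin m) ℂ ^ 3, f p = 0) (p : MvPolynomial (Fin m) ℂ) :
    descend f hf (quot m p) = f p := rfl

/-- The value at the origin of the first partial derivative with respect to `x`. -/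
def firstDeriv (x : Fin m) : FatRing m →ₗ[ℂ] ℂ :=
  descend ((aeval (R := ℂ) fun _ => (0 : ℂ)).toLinearMap ∘ₗ (pderiv x).toLinearMap) (fun p hp => by
    have := Ideal.pow_le_self two_ne_zero (pderiv_mem hp x)
    rw [mem_idealOfVars_iff] at this
    simpa [aeval_zero'] using this)

/-- The value at the origin of the second partial derivative with respect to `x` and `y`. -/
def secondDeriv (x y : Fin m) : FatRing m →ₗ[ℂ] ℂ :=
  descend ((aeval (R := ℂ) fun _ => (0 : ℂ)).toLinearMap ∘ₗ (pderiv x).toLinearMap ∘ₗ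
    (pderiv y).toLinearMap) (fun p hp => by
    have := pderiv_mem (k := 1) (pderiv_mem hp y) x
    rw [pow_one, mem_idealOfVars_iff] at this
    simpa [aeval_zero'] using this)

lemma firstDeriv_quot (x : Fin m) (p : MvPolynomial (Fin m) ℂ) :
    firstDeriv x (quot m p) = constantCoeff (pderiv x p) := by
  rw [firstDeriv, descend_quot]
  simp

lemma secondDeriv_quot (x y : Fin m) (p : MvPolynomial (Fin m) ℂ) :
    secondDeriv x y (quot m p) = constantCoeff (pderiv x (pderiv y p)) := by
  rw [secondDeriv, descend_quot]
  simp

/-- The ring is spanned by the constants, the linear forms and the products of two of them. -/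
lemma quot_sub_mem_span (p : MvPolynomial (Fin m) ℂ) :
    ∃ c : ℂ, quot m p - algebraMap ℂ _ c ∈ Submodule.span ℂ
      (Set.range (fun v => quot m (linearForm m v)) ∪
        {a | ∃ v w, a = quot m (linearForm m v) * quot m (linearForm m w)}) := by
  induction p using MvPolynomial.induction_on with
  | C c =>
    refine ⟨c, ?_⟩
    rw [show quot m (C c) = algebraMap ℂ _ c from rfl, sub_self]
    exact Submodule.zero_mem _
  | add p q hp hq =>
    obtain ⟨c, hc⟩ := hp
    obtain ⟨d, hd⟩ := hq
    refine ⟨c + d, ?_⟩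
    rw [map_add, map_add, add_sub_add_comm]
    exact Submodule.add_mem _ hc hd
  | mul_X p j hp =>
    obtain ⟨c, hc⟩ := hp
    refine ⟨0, ?_⟩
    have hX : X j = linearForm m (Pi.single j 1) := by
      simp [linearForm_apply, Pi.single_apply]
    rw [map_zero, sub_zero, map_mul, ← sub_add_cancel (quot m p) (algebraMap ℂ _ c), add_mul,
      ← Algebra.smul_def, hX]
    refine Submodule.add_mem _ ?_ (Submodule.smul_mem _ _ (Submodule.subset_span (Or.inl ⟨_, rfl⟩)))
    generalize quot m p - algebraMap ℂ _ c = b at hc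
    induction hc using Submodule.span_induction with
    | zero => rw [zero_mul]; exact Submodule.zero_mem _
    | add a b _ _ ha hb => rw [add_mul]; exact Submodule.add_mem _ ha hb
    | smul c a _ ha => rw [smul_mul_assoc]; exact Submodule.smul_mem _ _ ha
    | mem a ha =>
      rcases ha with ⟨v, rfl⟩ | ⟨v, w, rfl⟩
      · exact Submodule.subset_span (Or.inr ⟨_, _, rfl⟩)
      · rw [mul_mul_eq_zero]
        · exact Submodule.zero_mem _
        all_goals rw [augmentation_quot, constantCoeff_linearForm]

/-- The inclusion of the linear forms `V = ℂ^m` in the augmentation ideal. -/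
def linearFormIdeal (m : ℕ) : (Fin m → ℂ) →ₗ[ℂ] RingHom.ker (augmentation m) where
  toFun v := ⟨quot m (linearForm m v), (augmentation_quot _).trans (constantCoeff_linearForm v)⟩
  map_add' v w := Subtype.ext (by simp)
  map_smul' c v := Subtype.ext (by simp)

lemma coe_linearFormIdeal (v : Fin m → ℂ) :
    (linearFormIdeal m v : FatRing m) = quot m (linearForm m v) := rfl

open AugTor in
/-- Coordinates for `ℂ[x_1, …, x_m] / (x_1, …, x_m)^3`: the values at the origin of
the first and second partial derivatives. -/
def cubeZero (m : ℕ) : CubeZero (augmentation m) (Fin m) where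
  ι := linearFormIdeal m
  lin x := firstDeriv x ∘ₗ Bar.incl (augmentation m)
  quad x y := secondDeriv x y ∘ₗ Bar.incl (augmentation m)
  cube a b c := mul_mul_eq_zero _ _ _ a.2 b.2 c.2
  span a := by
    obtain ⟨p, hp⟩ := Ideal.Quotient.mkₐ_surjective ℂ _ (a : FatRing m)
    obtain ⟨c, hc⟩ := quot_sub_mem_span p
    have hi : Function.Injective (Bar.incl (augmentation m)) := Subtype.val_injective
    have himg : Bar.incl (augmentation m) '' (Set.range (linearFormIdeal m) ∪
        {a | ∃ v w, a = (linearFormIdeal m v : FatRing m) • linearFormIdeal m w}) =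
        (Set.range (fun v => quot m (linearForm m v)) ∪
          {a | ∃ v w, a = quot m (linearForm m v) * quot m (linearForm m w)}) := by
      rw [Set.image_union, ← Set.range_comp]
      congr 1
      ext b
      constructor
      · rintro ⟨_, ⟨v, w, rfl⟩, rfl⟩
        exact ⟨v, w, rfl⟩
      · rintro ⟨v, w, rfl⟩
        exact ⟨_, ⟨v, w, rfl⟩, rfl⟩
    rw [← himg, ← Submodule.map_span] at hc
    obtain ⟨s, hs, hs'⟩ := hc
    have hc0 : c = 0 := by
      have h1 := congrArg (augmentation m) hs'
      rw [map_sub, AlgHom.commutes, show quot m p = a from hp, show augmentation m a = 0 from a.2,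
        show augmentation m (Bar.incl (augmentation m) s) = 0 from s.2] at h1
      simpa using h1
    rw [hc0, map_zero, sub_zero, show quot m p = a from hp] at hs'
    rwa [← hi hs']
  lin_ι x v := by
    change firstDeriv x (quot m (linearForm m v)) = v x
    rw [firstDeriv_quot, pderiv_linearForm, constantCoeff_C]
  lin_mul x v w := by
    change firstDeriv x (quot m (linearForm m v) * quot m (linearForm m w)) = 0
    rw [← map_mul, firstDeriv_quot, Derivation.leibniz]
    simp [constantCoeff_linearForm]
  quad_ι x y v := by
    change secondDeriv x y (quot m (linearForm m v)) = 0
    rw [secondDeriv_quot, pderiv_linearForm, pderiv_C, map_zero]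
  quad_mul x y v w := by
    change secondDeriv x y (quot m (linearForm m v) * quot m (linearForm m w)) = _
    rw [← map_mul, secondDeriv_quot, Derivation.leibniz, map_add, smul_eq_mul, smul_eq_mul,
      Derivation.leibniz, Derivation.leibniz]
    simp [pderiv_linearForm]
    ring

/-- The linear forms are the standard representation. -/
lemma idealMap_linearFormIdeal (g : GL (Fin m) ℂ) (v : Fin m → ℂ) :
    AugTor.Bar.idealMap (augmentation_glAction m g) (linearFormIdeal m v) =
      linearFormIdeal m (standardRep m g v) := by
  apply Subtype.ext
  rw [AugTor.Bar.coe_idealMap, coe_linearFormIdeal, coe_linearFormIdeal]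
  change quot m (substitution g.1 (linearForm m v)) = _
  congr 1
  simp only [linearForm_apply, map_sum, map_smul, substitution, aeval_X, standardRep]
  simp only [MonoidHom.coe_mk, OneHom.coe_mk, Matrix.toLin'_apply, Matrix.mulVec, dotProduct,
    Finset.smul_sum, Finset.sum_smul, smul_smul]
  rw [Finset.sum_comm]
  simp only [mul_comm]

end FatPoint

end

/-! ### Sets of commuting adjacent transpositions -/

noncomputable section

namespace TypeA
open Coxeter

lemma commute_simpleTransposition_iff {N : ℕ} (a b : Fin (N - 1)) :
    Commute (simpleTransposition N a) (simpleTransposition N b) ↔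
      (a : ℕ) + 1 ≠ b ∧ (b : ℕ) + 1 ≠ a := by
  have key : ∀ a b : Fin (N - 1), (a : ℕ) + 1 = b →
      ¬ Commute (simpleTransposition N a) (simpleTransposition N b) := by
    intro a b hab hc
    have := congrArg (fun σ : Equiv.Perm (Fin N) => (σ ⟨a, by omega⟩ : ℕ)) hc.eq
    simp only [Equiv.Perm.mul_apply, simpleTransposition, Equiv.swap_apply_def, Fin.ext_iff] at this
    grind
  constructor
  · intro h
    exact ⟨fun h' => key a b h' h, fun h' => key b a h' h.symm⟩
  · rintro ⟨h1, h2⟩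
    ext x : 2
    simp only [Equiv.Perm.mul_apply, simpleTransposition, Equiv.swap_apply_def, Fin.ext_iff]
    grind

/-- The indicator function of a set of generators, extended by zero to all natural numbers. -/
def pattern {N : ℕ} (T : Finset (Fin (N - 1))) (a : ℕ) : Bool :=
  decide (∃ h : a < N - 1, (⟨a, h⟩ : Fin (N - 1)) ∈ T)

lemma pattern_eq_true_iff {N : ℕ} (T : Finset (Fin (N - 1))) (a : ℕ) :
    pattern T a = true ↔ ∃ h : a < N - 1, (⟨a, h⟩ : Fin (N - 1)) ∈ T := by
  simp [pattern]

lemma pattern_coe {N : ℕ} (T : Finset (Fin (N - 1))) (a : Fin (N - 1)) :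
    pattern T a = true ↔ a ∈ T := by
  simp [pattern]

lemma pattern_injective {N : ℕ} : Function.Injective (pattern (N := N)) := by
  intro T T' h
  ext a
  rw [← pattern_coe, h, pattern_coe]

lemma pattern_insert {N : ℕ} (T : Finset (Fin (N - 1))) (s : Fin (N - 1)) :
    pattern (insert s T) = Function.update (pattern T) s true := by
  funext a
  rw [Function.update_apply, Bool.eq_iff_iff, pattern_eq_true_iff]
  split_ifs with h
  · subst h
    simp
  · rw [pattern_eq_true_iff]
    refine exists_congr fun h' => ?_
    rw [Finset.mem_insert, or_iff_right]
    rintro rfl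
    exact h rfl

lemma count_pattern {N : ℕ} (T : Finset (Fin (N - 1))) (b : ℕ) :
    Nat.count (fun a => pattern T a = true) b =
      (T.filter fun a : Fin (N - 1) => (a : ℕ) < b).card := by
  rw [Nat.count_eq_card_filter_range, ← Finset.card_map Fin.valEmbedding]
  congr 1
  ext a
  simp only [Finset.mem_filter, Finset.mem_range, Finset.mem_map, Fin.valEmbedding_apply,
    pattern_eq_true_iff]
  constructor
  · rintro ⟨h1, h2, h3⟩
    exact ⟨⟨a, h2⟩, ⟨h3, h1⟩, rfl⟩
  · rintro ⟨c, ⟨h1, h2⟩, rfl⟩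
    exact ⟨h2, c.2, h1⟩

variable {N n k : ℕ}

lemma fits_pattern (hN : N = n + k) (T : CommutingSet (simpleTransposition N) k) :
    Fits n N (pattern T.1) where
  lt a ha := by
    obtain ⟨h, -⟩ := (pattern_eq_true_iff _ _).1 ha
    omega
  sep a ha := by
    by_contra hb
    obtain ⟨h, ha⟩ := (pattern_eq_true_iff _ _).1 ha
    obtain ⟨h', hb⟩ := (pattern_eq_true_iff _ _).1 (by simpa using hb)
    exact ((commute_simpleTransposition_iff _ _).1 (T.2.2 _ ha _ hb)).1 rfl
  eq := by
    rw [count_pattern, Finset.filter_true_of_mem (fun a _ => by omega), T.2.1, hN]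

/-- A pattern of pairwise nonadjacent positions, as a set of commuting generators. -/
lemma exists_commutingSet {T : ℕ → Bool} (hT : Fits n N T) :
    ∃ k, k ≤ n ∧ N = n + k ∧ ∃ U : CommutingSet (simpleTransposition N) k, pattern U.1 = T := by
  let U : Finset (Fin (N - 1)) := Finset.univ.filter fun a => T a = true
  have hU : pattern U = T := by
    funext a
    rw [Bool.eq_iff_iff, pattern_eq_true_iff]
    constructor
    · rintro ⟨h, h'⟩
      simpa [U] using h'
    · intro h
      exact ⟨by have := hT.lt a h; omega, by simpa [U] using h⟩
  have hc := hT.eq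
  rw [← hU, count_pattern, Finset.filter_true_of_mem (fun a _ => by omega)] at hc
  refine ⟨U.card, ?_, hc, ⟨U, rfl, fun a ha b hb => ?_⟩, hU⟩
  · have := hT.le_two_mul
    omega
  · rw [commute_simpleTransposition_iff]
    simp only [U, Finset.mem_filter, Finset.mem_univ, true_and] at ha hb
    constructor
    · intro h
      have := hT.sep a ha
      rw [h, hb] at this
      simp at this
    · intro h
      have := hT.sep b hb
      rw [h, ha] at this
      simp at this

lemma isEmpty_commutingSet (hN : N = n + k) (hk : n < k) :
    IsEmpty (CommutingSet (simpleTransposition N) k) :=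
  ⟨fun T => by have := (fits_pattern hN T).le_two_mul; omega⟩

instance : Finite (CommutingSet (simpleTransposition N) k) :=
  inferInstanceAs (Finite {T : Finset (Fin (N - 1)) // T.card = k ∧
    ∀ a ∈ T, ∀ b ∈ T, Commute (simpleTransposition N a) (simpleTransposition N b)})

instance : Fintype (CommutingSet (simpleTransposition N) k) := Fintype.ofFinite _

/-- Adding to `T` a generator with no neighbour in the pattern of `T` yields a commuting set. -/
lemma exists_erase_eq (T : CommutingSet (simpleTransposition N) k) (s : Fin (N - 1))
    (h : AugTor.CubeZero.Free (pattern T.1) s) :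
    ∃ (U : CommutingSet (simpleTransposition N) (k + 1)) (hs : s ∈ U.1), U.erase s hs = T := by
  have hs : s ∉ T.1 := by
    rw [← pattern_coe, h.1]
    simp
  have hc : ∀ b ∈ T.1, Commute (simpleTransposition N s) (simpleTransposition N b) := by
    intro b hb
    rw [commute_simpleTransposition_iff]
    rw [← pattern_coe] at hb
    constructor
    · intro h'
      rw [← h', h.2.1] at hb
      simp at hb
    · intro h'
      rw [h.2.2 b h'.symm] at hb
      simp at hb
  refine ⟨⟨insert s T.1, by rw [Finset.card_insert_of_notMem hs, T.2.1], ?_⟩,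
    Finset.mem_insert_self _ _, Subtype.ext (Finset.erase_insert hs)⟩
  intro a ha b hb
  rcases Finset.mem_insert.1 ha with rfl | ha' <;> rcases Finset.mem_insert.1 hb with rfl | hb'
  · exact Commute.refl _
  · exact hc b hb'
  · exact (hc a ha').symm
  · exact T.2.2 a ha' b hb'

lemma free_erase (U : CommutingSet (simpleTransposition N) (k + 1)) (s : Fin (N - 1))
    (hs : s ∈ U.1) : AugTor.CubeZero.Free (pattern (U.1.erase s)) s := by
  refine ⟨?_, ?_, fun r hr => ?_⟩
  · by_contra h
    have := (pattern_coe _ _).1 (by simpa using h)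
    simp at this
  · by_contra h
    obtain ⟨h1, h2⟩ := (pattern_eq_true_iff _ _).1 (by simpa using h)
    exact ((commute_simpleTransposition_iff _ _).1
      (U.2.2 _ hs _ (Finset.mem_of_mem_erase h2))).1 rfl
  · by_contra h
    obtain ⟨h1, h2⟩ := (pattern_eq_true_iff _ _).1 (by simpa using h)
    exact ((commute_simpleTransposition_iff _ _).1
      (U.2.2 _ hs _ (Finset.mem_of_mem_erase h2))).2 hr.symm

end TypeA

end

/-! ### The comparison of the Coxeter complexes with the bar complex -/

noncomputable section

open scoped TensorProduct

namespace AugTor.CubeZero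
open Bar Coxeter TypeA

variable {R : Type} [CommRing R] [Algebra ℂ R] {ε : R →ₐ[ℂ] ℂ} {X : Type} (S : CubeZero ε X)
variable {n N k : ℕ}

/-- The extension by zero of a finite sequence of vectors. -/
def extend (v : Fin N → X → ℂ) (a : ℕ) : X → ℂ := if h : a < N then v ⟨a, h⟩ else 0

lemma extend_update (v : Fin N → X → ℂ) (i : Fin N) (x : X → ℂ) :
    extend (Function.update v i x) = Function.update (extend v) i x := by
  funext a
  rw [Function.update_apply]
  by_cases h : a < N
  · simp [extend, h, Function.update_apply, Fin.ext_iff]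
  · simp only [extend, h, dite_false]
    rw [if_neg]
    omega

lemma extend_comp_swap (v : Fin N → X → ℂ) (t : Fin (N - 1)) :
    extend (v ∘ simpleTransposition N t) = extend v ∘ Equiv.swap (t : ℕ) (t + 1) := by
  funext a
  simp only [extend, Function.comp_apply, simpleTransposition, Equiv.swap_apply_def, Fin.ext_iff]
  grind

open scoped Classical in
/-- The linear map `V^{⊗N} → 𝔪^{⊗n}` that multiplies the letters `t` and `t + 1` for all
`t ∈ T`. It is zero by convention if the numbers `n` and `N` do not match. -/
def wordLift (n N : ℕ) (T : ℕ → Bool) : (⨂[ℂ]^N (X → ℂ)) →ₗ[ℂ] barSpace ε n :=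
  if hT : Fits n N T then PiTensorProduct.lift
    { toFun := fun v => S.word n T (extend v)
      map_update_add' := fun {inst} v i x y => by
        obtain ⟨L, hL⟩ := S.exists_word_update n hT (extend v) i.2
        rw [Subsingleton.elim inst (instDecidableEqFin N)]
        simp only [extend_update, hL, map_add]
      map_update_smul' := fun {inst} v i c x => by
        obtain ⟨L, hL⟩ := S.exists_word_update n hT (extend v) i.2
        rw [Subsingleton.elim inst (instDecidableEqFin N)]
        simp only [extend_update, hL, map_smul] }
  else 0

lemma wordLift_tprod {T : ℕ → Bool} (hT : Fits n N T) (v : Fin N → X → ℂ) :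
    S.wordLift n N T (PiTensorProduct.tprod ℂ v) = S.word n T (extend v) := by
  rw [wordLift, dif_pos hT, PiTensorProduct.lift.tprod]
  rfl

lemma power_ext {N : ℕ} {V E : Type} [AddCommGroup V] [Module ℂ V] [AddCommGroup E] [Module ℂ E]
    {f g : (⨂[ℂ]^N V) →ₗ[ℂ] E}
    (h : ∀ v : Fin N → V, f (PiTensorProduct.tprod ℂ v) = g (PiTensorProduct.tprod ℂ v)) :
    f = g :=
  PiTensorProduct.ext (MultilinearMap.ext h)

/-- The map `wordLift` factors through the coinvariants of `⟨T⟩`. -/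
lemma wordLift_permRep (hN : N = n + k) (T : CommutingSet (simpleTransposition N) k)
    {t : Fin (N - 1)} (ht : t ∈ T.1) (c : ⨂[ℂ]^N (X → ℂ)) :
    S.wordLift n N (pattern T.1) (permRep (X → ℂ) N (simpleTransposition N t) c) =
      S.wordLift n N (pattern T.1) c := by
  have hT := fits_pattern hN T
  refine LinearMap.congr_fun (f := S.wordLift n N (pattern T.1) ∘ₗ
    permRep (X → ℂ) N (simpleTransposition N t)) (power_ext fun v => ?_) c
  have h1 : permRep (X → ℂ) N (simpleTransposition N t) (PiTensorProduct.tprod ℂ v) =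
      PiTensorProduct.tprod ℂ (v ∘ simpleTransposition N t) := by
    refine (PiTensorProduct.reindex_tprod _ _).trans ?_
    rw [simpleTransposition, Equiv.symm_swap]
    rfl
  rw [LinearMap.comp_apply, h1, S.wordLift_tprod hT, S.wordLift_tprod hT, extend_comp_swap]
  exact S.word_swap n hT.sep _ ((pattern_coe _ _).2 ht)

lemma wordLift_permRep_of_mem (hN : N = n + k) (T : CommutingSet (simpleTransposition N) k)
    {σ : Equiv.Perm (Fin N)} (hσ : σ ∈ Subgroup.closure (simpleTransposition N '' (T.1 : Set _)))
    (c : ⨂[ℂ]^N (X → ℂ)) :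
    S.wordLift n N (pattern T.1) (permRep (X → ℂ) N σ c) = S.wordLift n N (pattern T.1) c := by
  induction hσ using Subgroup.closure_induction generalizing c with
  | mem x hx => obtain ⟨t, ht, rfl⟩ := hx; exact S.wordLift_permRep hN T ht c
  | one => rw [map_one, Module.End.one_apply]
  | mul x y _ _ hx hy => rw [map_mul, Module.End.mul_apply, hx, hy]
  | inv x _ hx =>
    rw [← hx, ← Module.End.mul_apply, ← map_mul, mul_inv_cancel, map_one, Module.End.one_apply]

open scoped Classical in
lemma diff_wordLift (hN : N = n + 1 + k) (T : CommutingSet (simpleTransposition N) k)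
    (c : ⨂[ℂ]^N (X → ℂ)) :
    diff ε n (S.wordLift (n + 1) N (pattern T.1) c) =
      ∑ s : Fin (N - 1), if Free (pattern T.1) s then
        (-1 : ℂ) ^ ((s : ℕ) + Nat.count (fun a => pattern T.1 a = true) s) •
          S.wordLift n N (pattern (insert s T.1)) c else 0 := by
  have hT := fits_pattern hN T
  have key : diff ε n ∘ₗ S.wordLift (n + 1) N (pattern T.1) =
      ∑ s : Fin (N - 1), if Free (pattern T.1) s then
        (-1 : ℂ) ^ ((s : ℕ) + Nat.count (fun a => pattern T.1 a = true) s) •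
          S.wordLift n N (pattern (insert s T.1)) else 0 := by
    refine power_ext fun v => ?_
    rw [LinearMap.comp_apply, S.wordLift_tprod hT, S.diff_word n hT, Finset.sum_range,
      LinearMap.sum_apply]
    refine Finset.sum_congr rfl fun s _ => ?_
    split_ifs with hs
    · obtain ⟨U, hsU, rfl⟩ := exists_erase_eq T s hs
      have h1 : insert s (U.erase s hsU).1 = U.1 := Finset.insert_erase hsU
      rw [LinearMap.smul_apply, ← pattern_insert, h1,
        S.wordLift_tprod (fits_pattern (by omega) U)]
    · rfl
  refine (LinearMap.congr_fun key c).trans ?_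
  rw [LinearMap.sum_apply]
  refine Finset.sum_congr rfl fun s _ => ?_
  split_ifs <;> rfl

lemma map_wordLift {σ : R ≃ₐ[ℂ] R} (h : ∀ r, ε (σ r) = ε r) {H : Type*} [Group H]
    (π : Representation ℂ H (X → ℂ)) (g : H)
    (hg : ∀ v, idealMap h (S.ι v) = S.ι (π g v)) (hN : N = n + k)
    (T : CommutingSet (simpleTransposition N) k) (c : ⨂[ℂ]^N (X → ℂ)) :
    Bar.map h n (S.wordLift n N (pattern T.1) c) =
      S.wordLift n N (pattern T.1) (powerRep π N g c) := by
  have hT := fits_pattern hN T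
  refine LinearMap.congr_fun (f := Bar.map h n ∘ₗ S.wordLift n N (pattern T.1))
    (g := S.wordLift n N (pattern T.1) ∘ₗ powerRep π N g) (power_ext fun v => ?_) c
  have h1 : powerRep π N g (PiTensorProduct.tprod ℂ v) =
      PiTensorProduct.tprod ℂ (fun i => π g (v i)) :=
    PiTensorProduct.map_tprod _ _
  rw [LinearMap.comp_apply, LinearMap.comp_apply, h1, S.wordLift_tprod hT, S.wordLift_tprod hT,
    S.map_word h (π g) hg]
  congr 1
  funext a
  simp only [extend]
  split_ifs
  · rfl
  · exact map_zero _

/-- The sign `(-1)^{∑ T}`, which accounts for the difference between the signs of the bar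
differential and of the Coxeter differential. The generators are numbered from `0`. -/
def sign (T : Finset (Fin (N - 1))) : ℂ := ∏ t ∈ T, (-1) ^ (t : ℕ)

lemma sign_mul_self (T : Finset (Fin (N - 1))) : sign T * sign T = 1 := by
  rw [sign, ← Finset.prod_mul_distrib]
  refine Finset.prod_eq_one fun t _ => ?_
  rw [← mul_pow]
  simp

lemma sign_ne_zero (T : Finset (Fin (N - 1))) : sign T ≠ 0 := fun h => by
  have := sign_mul_self T
  rw [h] at this
  simp at this

/-- The map from the Coxeter cochains of `S_N` in degree `k` to the bar complex, meaningful for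
`N = n + k`. The factor `2^{-k}` compensates for `v + s(v)` having twice the image of `v` in the
coinvariants of `s`. -/
def coxeterMap (n N k : ℕ) :
    Cochain (simpleTransposition N) (permRep (X → ℂ) N) k →ₗ[ℂ] barSpace ε n :=
  ((2 : ℂ)⁻¹ ^ k) • ∑ T : CommutingSet (simpleTransposition N) k,
    sign T.1 • (S.wordLift n N (pattern T.1) ∘ₗ
      (invariants (simpleTransposition N) (permRep (X → ℂ) N) T.1).subtype ∘ₗ LinearMap.proj T)

lemma coxeterMap_apply (n N k : ℕ)
    (c : Cochain (simpleTransposition N) (permRep (X → ℂ) N) k) :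
    S.coxeterMap n N k c = ((2 : ℂ)⁻¹ ^ k) • ∑ T : CommutingSet (simpleTransposition N) k,
      sign T.1 • S.wordLift n N (pattern T.1) (c T : ⨂[ℂ]^N (X → ℂ)) := by
  simp [coxeterMap, LinearMap.sum_apply]

lemma map_coxeterMap {σ : R ≃ₐ[ℂ] R} (h : ∀ r, ε (σ r) = ε r) {H : Type*} [Group H]
    (π : Representation ℂ H (X → ℂ)) (g : H)
    (hg : ∀ v, idealMap h (S.ι v) = S.ι (π g v)) (hN : N = n + k)
    (c : Cochain (simpleTransposition N) (permRep (X → ℂ) N) k) :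
    Bar.map h n (S.coxeterMap n N k c) = S.coxeterMap n N k
      (cochainMap _ _ (powerRep π N g) (fun τ => commute_permRep_powerRep π N τ g) k c) := by
  rw [coxeterMap_apply, coxeterMap_apply, map_smul, map_sum]
  congr 1
  refine Finset.sum_congr rfl fun T _ => ?_
  rw [map_smul, S.map_wordLift h π g hg hN]
  rfl

/-- The map `coxeterMap` is compatible with the differentials. Both sides are sums over the pairs of
a set `U` of `k + 1` commuting generators and an element `t` of `U`; the bar differential leads to
the description by `U \ {t}` and `t`. -/
lemma diff_coxeterMap (hN : N = n + 1 + k)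
    (c : Cochain (simpleTransposition N) (permRep (X → ℂ) N) k) :
    diff ε n (S.coxeterMap (n + 1) N k c) =
      S.coxeterMap n N (k + 1) (d (simpleTransposition_mul_self N) (permRep (X → ℂ) N) k c) := by
  classical
  have hN' : N = n + (k + 1) := by omega
  rw [coxeterMap_apply, coxeterMap_apply, map_smul, map_sum, pow_succ, mul_smul]
  congr 1
  rw [Finset.smul_sum]
  have hL : ∀ T : CommutingSet (simpleTransposition N) k,
      diff ε n (sign T.1 • S.wordLift (n + 1) N (pattern T.1) (c T : ⨂[ℂ]^N (X → ℂ))) =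
      ∑ s ∈ Finset.univ.filter (fun s : Fin (N - 1) => Free (pattern T.1) s),
        (sign T.1 * (-1 : ℂ) ^ ((s : ℕ) + Nat.count (fun a => pattern T.1 a = true) s)) •
          S.wordLift n N (pattern (insert s T.1)) (c T : ⨂[ℂ]^N (X → ℂ)) := fun T => by
    rw [map_smul, S.diff_wordLift hN, Finset.smul_sum, Finset.sum_filter]
    refine Finset.sum_congr rfl fun s _ => ?_
    split_ifs
    · rw [smul_smul]
    · rw [smul_zero]
  have hR : ∀ U : CommutingSet (simpleTransposition N) (k + 1),
      (2 : ℂ)⁻¹ • sign U.1 • S.wordLift n N (pattern U.1) ((d (simpleTransposition_mul_self N)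
        (permRep (X → ℂ) N) k c U : _) : ⨂[ℂ]^N (X → ℂ)) =
      ∑ t : {t // t ∈ U.1},
        (sign U.1 * (-1 : ℂ) ^ ((U.1.erase t).filter (· < (t : Fin (N - 1)))).card) •
          S.wordLift n N (pattern U.1) (c (U.erase t t.2) : ⨂[ℂ]^N (X → ℂ)) := fun U => by
    simp only [d, LinearMap.coe_mk, AddHom.coe_mk, AddSubmonoidClass.coe_finsetSum, map_sum,
      Finset.smul_sum]
    refine Finset.sum_congr rfl fun t _ => ?_
    rw [dComponent, LinearMap.smul_apply, LinearMap.add_apply, LinearMap.id_apply, map_smul,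
      map_add, S.wordLift_permRep hN' U t.2, ← two_smul ℂ, smul_smul, smul_smul, smul_smul]
    congr 1
    ring
  rw [Finset.sum_congr rfl (fun T _ => hL T), Finset.sum_congr rfl (fun U _ => hR U),
    Finset.sum_sigma', Finset.sum_sigma']
  symm
  refine Finset.sum_bij (fun x _ => ⟨x.1.erase x.2 x.2.2, x.2⟩) ?_ ?_ ?_ ?_
  · rintro ⟨U, t⟩ -
    simp only [Finset.mem_sigma, Finset.mem_univ, true_and, Finset.mem_filter]
    exact free_erase U t t.2
  · rintro ⟨U, t, ht⟩ - ⟨U', t', ht'⟩ - h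
    simp only [Sigma.mk.injEq] at h
    obtain ⟨h1, h2⟩ := h
    obtain rfl := eq_of_heq h2
    have h3 : U.1.erase t = U'.1.erase t := congrArg Subtype.val h1
    obtain rfl : U = U' := Subtype.ext (by
      rw [← Finset.insert_erase ht, h3, Finset.insert_erase ht'])
    rfl
  · rintro ⟨T, s⟩ h
    simp only [Finset.mem_sigma, Finset.mem_univ, true_and, Finset.mem_filter] at h
    obtain ⟨U, hs, rfl⟩ := exists_erase_eq T s h
    exact ⟨⟨U, s, hs⟩, Finset.mem_sigma.2 ⟨Finset.mem_univ _, Finset.mem_univ _⟩, rfl⟩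
  · rintro ⟨U, t, ht⟩ -
    have h1 : insert t (U.erase t ht).1 = U.1 := Finset.insert_erase ht
    have h2 : sign U.1 = (-1) ^ (t : ℕ) * sign (U.1.erase t) :=
      (Finset.mul_prod_erase _ _ ht).symm
    dsimp only
    rw [h1, h2, count_pattern, pow_add]
    congr 1
    change _ = sign (U.1.erase t) * ((-1) ^ (t : ℕ) *
      (-1) ^ ((U.1.erase t).filter fun a : Fin (N - 1) => (a : ℕ) < t).card)
    simp only [Fin.lt_def]
    ring

end AugTor.CubeZero

end

/-! ### Bijectivity of the comparison -/

noncomputable section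

open scoped TensorProduct

namespace AugTor.CubeZero
open Bar Coxeter TypeA

variable {R : Type} [CommRing R] [Algebra ℂ R] {ε : R →ₐ[ℂ] ℂ} {X : Type} (S : CubeZero ε X)
variable {n N k : ℕ}

/-- The basis of `V^{⊗N}` consisting of the tensor products of basis vectors of `V = ℂ^X`. -/
def powerBasis (X : Type) [Fintype X] [DecidableEq X] (N : ℕ) :
    Module.Basis (Fin N → X) ℂ (⨂[ℂ]^N (X → ℂ)) :=
  Basis.piTensorProduct fun _ => Pi.basisFun ℂ X

lemma coord_wordLift_eq_zero {T T' : ℕ → Bool} {N' : ℕ} (hT : Fits n N T) (hT' : Fits n N' T')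
    (h : T ≠ T') (y : ℕ → X) (c : ⨂[ℂ]^N' (X → ℂ)) :
    S.coord n T y (S.wordLift n N' T' c) = 0 := by
  refine LinearMap.congr_fun (f := S.coord n T y ∘ₗ S.wordLift n N' T') (g := 0)
    (power_ext fun v => ?_) c
  rw [LinearMap.comp_apply, S.wordLift_tprod hT', LinearMap.zero_apply]
  by_contra h'
  exact h (S.eq_of_coord_word_ne_zero n hT hT' _ _ h')

section
variable [Fintype X] [DecidableEq X]

lemma powerBasis_apply (x : Fin N → X) :
    powerBasis X N x = PiTensorProduct.tprod ℂ fun i => Pi.single (x i) (1 : ℂ) := by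
  rw [powerBasis, Basis.piTensorProduct_apply]
  simp only [Pi.basisFun_apply]

lemma powerBasis_repr_permRep (σ : Equiv.Perm (Fin N)) (c : ⨂[ℂ]^N (X → ℂ)) (x : Fin N → X) :
    (powerBasis X N).repr (permRep (X → ℂ) N σ c) x = (powerBasis X N).repr c (x ∘ σ) := by
  refine LinearMap.congr_fun (f := (powerBasis X N).coord x ∘ₗ permRep (X → ℂ) N σ)
    (g := (powerBasis X N).coord (x ∘ σ)) (power_ext fun v => ?_) c
  have h1 : permRep (X → ℂ) N σ (PiTensorProduct.tprod ℂ v) =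
      PiTensorProduct.tprod ℂ (fun i => v (σ.symm i)) :=
    PiTensorProduct.reindex_tprod _ _
  rw [LinearMap.comp_apply, h1, Module.Basis.coord_apply, Module.Basis.coord_apply, powerBasis,
    Basis.piTensorProduct_repr_tprod_apply, Basis.piTensorProduct_repr_tprod_apply,
    ← Equiv.prod_comp σ]
  simp

/-- The coordinates of the image of an invariant tensor under `wordLift` determine the tensor.

The basis vectors that contribute to the coordinate for `y` agree with `y` up to exchanging letters,
so all of them have the same coefficient in `c` as `y`. The coordinate is thus this coefficient
times the coordinate of the sum of all basis vectors, which is not zero. -/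
lemma eq_zero_of_coord_wordLift (hN : N = n + k) (h0 : 0 < N)
    (T : CommutingSet (simpleTransposition N) k) (c : ⨂[ℂ]^N (X → ℂ))
    (hc : c ∈ invariants (simpleTransposition N) (permRep (X → ℂ) N) T.1)
    (h : ∀ y, S.coord n (pattern T.1) y (S.wordLift n N (pattern T.1) c) = 0) : c = 0 := by
  have hT := fits_pattern hN T
  rw [mem_invariants_iff] at hc
  refine (powerBasis X N).ext_elem fun y₀ => ?_
  rw [map_zero, Finsupp.zero_apply]
  -- The indices beyond `N` do not matter; some value for them exists because `N` is positive.
  let ext : (Fin N → X) → ℕ → X := fun x a => if h : a < N then x ⟨a, h⟩ else y₀ ⟨0, h0⟩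
  have hext : ∀ x (i : Fin N), ext x i = x i := fun x i => by simp [ext]
  let C : (ℕ → X) → ℂ := fun z => (powerBasis X N).repr c (fun i => z i)
  have hC : ∀ x, C (ext x) = (powerBasis X N).repr c x := fun x => by simp only [C, hext]
  have hword : ∀ x, S.wordLift n N (pattern T.1) (powerBasis X N x) =
      S.word n (pattern T.1) (fun a => Pi.single (ext x a) 1) := fun x => by
    rw [powerBasis_apply, S.wordLift_tprod hT]
    exact S.word_congr n hT fun a ha => by simp [extend, ext, ha]
  have hswap : ∀ t, pattern T.1 t = true → ∀ z, C (z ∘ Equiv.swap t (t + 1)) = C z := by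
    intro t ht z
    obtain ⟨ht', ht⟩ := (pattern_eq_true_iff _ _).1 ht
    simp only [C]
    conv_rhs => rw [← hc _ ht, powerBasis_repr_permRep]
    congr 1
    funext i
    simp only [Function.comp_apply, simpleTransposition]
    congr 1
    simp only [Equiv.swap_apply_def, Fin.ext_iff]
    grind
  have hone : ∑ x, powerBasis X N x = PiTensorProduct.tprod ℂ (fun _ : Fin N => (1 : X → ℂ)) := by
    have h1 : (1 : X → ℂ) = ∑ j, Pi.single j (1 : ℂ) := (Finset.univ_sum_single _).symm
    rw [h1, MultilinearMap.map_sum]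
    exact Finset.sum_congr rfl fun x _ => powerBasis_apply x
  have key : (powerBasis X N).repr c y₀ * S.coord n (pattern T.1) (ext y₀)
      (S.word n (pattern T.1) fun _ => 1) = 0 := by
    have h2 : S.word n (pattern T.1) (fun _ => (1 : X → ℂ)) =
        S.wordLift n N (pattern T.1) (∑ x, powerBasis X N x) := by
      rw [hone, S.wordLift_tprod hT]
      exact S.word_congr n hT fun a ha => by simp [extend, ha]
    rw [h2, map_sum, map_sum, Finset.mul_sum, ← h (ext y₀)]
    conv_rhs => rw [← (powerBasis X N).sum_repr c, map_sum, map_sum]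
    refine Finset.sum_congr rfl fun x _ => ?_
    rw [map_smul, map_smul, smul_eq_mul, hword]
    by_cases hz : S.coord n (pattern T.1) (ext y₀)
      (S.word n (pattern T.1) fun a => Pi.single (ext x a) 1) = 0
    · rw [hz, mul_zero, mul_zero]
    · rw [← hC, ← hC, S.eq_of_coord_word_single_ne_zero n hT (ext x) (ext y₀) C
        (fun z z' hz => by
          simp only [C]
          congr 1
          funext i
          exact hz i i.2) hswap hz]
  exact (mul_eq_zero.1 key).resolve_right (S.coord_word_one_ne_zero n _ _)

/-- The maps `coxeterMap` for varying `k` are jointly injective. -/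
lemma eq_zero_of_sum_coxeterMap_eq_zero {ι : Type*} [Fintype ι] {k N : ι → ℕ}
    (hk : Function.Injective k) (hN : ∀ j, N j = n + k j) (h0 : ∀ j, 0 < N j)
    (c : ∀ j, Cochain (simpleTransposition (N j)) (permRep (X → ℂ) (N j)) (k j))
    (h : ∑ j, S.coxeterMap n (N j) (k j) (c j) = 0) (j : ι) : c j = 0 := by
  classical
  funext T
  apply Subtype.ext
  refine S.eq_zero_of_coord_wordLift (hN j) (h0 j) T _ (c j T).2 fun y => ?_
  have h1 := congrArg (S.coord n (pattern T.1) y) h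
  have h2 : ∀ (i : ι) (U : CommutingSet (simpleTransposition (N i)) (k i)),
      pattern T.1 = pattern U.1 → i = j := fun i U hU => hk (by
    have hT := fits_pattern (hN j) T
    rw [hU] at hT
    have := hT.unique (fits_pattern (hN i) U)
    rw [hN, hN] at this
    omega)
  rw [map_sum, map_zero, Finset.sum_eq_single j, coxeterMap_apply, map_smul, map_sum,
    Finset.sum_eq_single T, map_smul] at h1
  · have h3 := (smul_eq_zero.1 h1).resolve_left (by simp)
    exact (smul_eq_zero.1 h3).resolve_left (sign_ne_zero _)
  · intro U _ hU
    rw [map_smul, S.coord_wordLift_eq_zero (fits_pattern (hN j) T) (fits_pattern (hN j) U)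
      (fun h => hU (Subtype.ext (pattern_injective h)).symm), smul_zero]
  · simp
  · intro i _ hi
    rw [coxeterMap_apply, map_smul, map_sum, Finset.sum_eq_zero, smul_zero]
    intro U _
    rw [map_smul, S.coord_wordLift_eq_zero (fits_pattern (hN j) T) (fits_pattern (hN i) U)
      (fun h => hi (h2 i U h)), smul_zero]
  · simp

end

/-- By averaging over `⟨T⟩`, the image of a tensor under `wordLift` is that of an invariant
tensor. -/
lemma exists_coxeterMap_eq (hN : N = n + k) (T : CommutingSet (simpleTransposition N) k)
    (u : ⨂[ℂ]^N (X → ℂ)) : ∃ c, S.coxeterMap n N k c = S.wordLift n N (pattern T.1) u := by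
  classical
  let H := Subgroup.closure (simpleTransposition N '' (T.1 : Set (Fin (N - 1))))
  let avg : ⨂[ℂ]^N (X → ℂ) := (Fintype.card H : ℂ)⁻¹ • ∑ σ : H, permRep (X → ℂ) N σ u
  have havg : avg ∈ invariants (simpleTransposition N) (permRep (X → ℂ) N) T.1 := by
    intro g hg
    simp only [avg, map_smul, map_sum]
    congr 1
    conv_rhs => rw [← Equiv.sum_comp (Equiv.mulLeft (⟨g, hg⟩ : H))]
    refine Finset.sum_congr rfl fun σ _ => ?_
    rw [← Module.End.mul_apply, ← map_mul]
    rfl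
  have hw : S.wordLift n N (pattern T.1) avg = S.wordLift n N (pattern T.1) u := by
    simp only [avg, map_smul, map_sum]
    rw [Finset.sum_congr rfl fun σ _ => S.wordLift_permRep_of_mem hN T (σ : H).2 u,
      Finset.sum_const, Finset.card_univ, ← Nat.cast_smul_eq_nsmul ℂ, smul_smul,
      inv_mul_cancel₀ (by simp), one_smul]
  let c : Cochain (simpleTransposition N) (permRep (X → ℂ) N) k :=
    Pi.single T (((2 : ℂ) ^ k * sign T.1) • ⟨avg, havg⟩)
  refine ⟨c, ?_⟩
  rw [coxeterMap_apply, Finset.sum_eq_single T]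
  · simp only [c, Pi.single_eq_same, Submodule.coe_smul, map_smul, hw, smul_smul]
    rw [mul_left_comm (sign T.1), sign_mul_self, mul_one, ← mul_pow]
    simp
  · intro U _ hU
    simp [c, Pi.single_eq_of_ne hU]
  · simp

/-- The maps `coxeterMap` for `k ≤ n` are jointly surjective. -/
lemma mem_span_coxeterMap (n : ℕ) (w : barSpace ε n) :
    w ∈ Submodule.span ℂ {w | ∃ k c, k ≤ n ∧ S.coxeterMap n (n + k) k c = w} := by
  have hw : w ∈ Submodule.span ℂ {w | ∃ N T v, Fits n N T ∧ S.word n T v = w} := by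
    rw [S.span_word]
    trivial
  refine Submodule.span_mono ?_ hw
  rintro _ ⟨N, T, v, hT, rfl⟩
  obtain ⟨k, hk, rfl, U, rfl⟩ := exists_commutingSet hT
  obtain ⟨c, hc⟩ := S.exists_coxeterMap_eq rfl U
    (PiTensorProduct.tprod ℂ fun i : Fin (n + k) => v i)
  refine ⟨k, c, hk, ?_⟩
  rw [hc, S.wordLift_tprod hT]
  exact S.word_congr n hT fun a ha => by simp [extend, ha]

end AugTor.CubeZero

end

/-! ### Passage to homology -/

noncomputable section

open CategoryTheory
open scoped TensorProduct

namespace Coxeter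

universe u
variable {K A : Type u} [CommRing K] [AddCommGroup A] [Module K A]
variable {G : Type*} [Group G] {S : Type} [LinearOrder S]

lemma cochainComplex_d {s : S → G} (hs : ∀ a, s a * s a = 1) (ρ : Representation K G A) (k : ℕ) :
    (cochainComplex hs ρ).d k (k + 1) = ModuleCat.ofHom (d hs ρ k) :=
  CochainComplex.of_d (fun k => ModuleCat.of K (Cochain s ρ k))
    (fun k => ModuleCat.ofHom (d hs ρ k)) k

end Coxeter

namespace AugTor.CubeZero
open Bar Coxeter TypeA

variable {R : Type} [CommRing R] [Algebra ℂ R] {ε : R →ₐ[ℂ] ℂ} {X : Type} (S : CubeZero ε X)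

/-- The sum of the maps `coxeterMap` from the Coxeter complexes of `S_n, …, S_{2n}` to `𝔪^{⊗n}`. -/
def totalMap (n : ℕ) : (∀ j : Fin (n + 1), Cochain (simpleTransposition (n + j))
    (permRep (X → ℂ) (n + j)) j) →ₗ[ℂ] barSpace ε n :=
  ∑ j : Fin (n + 1), S.coxeterMap n (n + j) j ∘ₗ LinearMap.proj j

lemma totalMap_apply (n : ℕ) (c : ∀ j : Fin (n + 1), Cochain (simpleTransposition (n + j))
    (permRep (X → ℂ) (n + j)) j) :
    S.totalMap n c = ∑ j : Fin (n + 1), S.coxeterMap n (n + j) j (c j) := by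
  simp [totalMap, LinearMap.sum_apply]

lemma totalMap_single (n : ℕ) (j : Fin (n + 1)) (c : Cochain (simpleTransposition (n + j))
    (permRep (X → ℂ) (n + j)) j) :
    S.totalMap n (Pi.single j c) = S.coxeterMap n (n + j) j c := by
  rw [totalMap_apply, Finset.sum_eq_single j]
  · rw [Pi.single_eq_same]
  · intro i _ hi
    rw [Pi.single_eq_of_ne hi, map_zero]
  · simp

lemma totalMap_bijective [Fintype X] [DecidableEq X] {n : ℕ} (hn : 1 ≤ n) :
    Function.Bijective (S.totalMap n) := by
  constructor
  · rw [injective_iff_map_eq_zero]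
    intro c hc
    rw [totalMap_apply] at hc
    funext j
    exact S.eq_zero_of_sum_coxeterMap_eq_zero (k := fun j : Fin (n + 1) => (j : ℕ))
      Fin.val_injective (fun j => rfl) (fun j => by omega) c hc j
  · intro w
    suffices h : w ∈ LinearMap.range (S.totalMap n) from h
    refine Submodule.span_le.2 ?_ (S.mem_span_coxeterMap n w)
    rintro _ ⟨k, c, hk, rfl⟩
    exact ⟨_, S.totalMap_single n ⟨k, by omega⟩ c⟩

lemma diff_totalMap_eq_zero_iff [Fintype X] [DecidableEq X] (n : ℕ)
    (c : ∀ j : Fin (n + 2), Cochain (simpleTransposition (n + 1 + j))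
      (permRep (X → ℂ) (n + 1 + j)) j) :
    diff ε n (S.totalMap (n + 1) c) = 0 ↔
      ∀ j : Fin (n + 2), d (simpleTransposition_mul_self _) (permRep (X → ℂ) _) j (c j) = 0 := by
  have h : diff ε n (S.totalMap (n + 1) c) = ∑ j : Fin (n + 2), S.coxeterMap n (n + 1 + j) (j + 1)
      (d (simpleTransposition_mul_self _) (permRep (X → ℂ) _) j (c j)) := by
    rw [totalMap_apply, map_sum]
    exact Finset.sum_congr rfl fun j _ => S.diff_coxeterMap rfl (c j)
  rw [h]
  constructor
  · intro h0
    exact S.eq_zero_of_sum_coxeterMap_eq_zero (k := fun j : Fin (n + 2) => (j : ℕ) + 1)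
      (N := fun j => n + 1 + j) (fun i j hij => Fin.ext (by simpa using hij)) (fun j => by omega)
      (fun j => by omega) _ h0
  · intro h0
    exact Finset.sum_eq_zero fun j _ => by rw [h0, map_zero]

/-- The coboundaries in the Coxeter complex of `S_N` with coefficients in `V^{⊗N}`. In degree `0`
there are none but zero. -/
def coboundaries (N : ℕ) : ∀ k,
    Submodule ℂ (Cochain (simpleTransposition N) (permRep (X → ℂ) N) k)
  | 0 => ⊥
  | k + 1 => LinearMap.range (d (simpleTransposition_mul_self N) (permRep (X → ℂ) N) k)

lemma totalMap_mem_range_diff_iff [Fintype X] [DecidableEq X] {n : ℕ} (hn : 1 ≤ n)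
    (c : ∀ j : Fin (n + 1), Cochain (simpleTransposition (n + j))
      (permRep (X → ℂ) (n + j)) j) :
    S.totalMap n c ∈ LinearMap.range (diff ε n) ↔
      ∀ j : Fin (n + 1), c j ∈ coboundaries (n + j) j := by
  constructor
  · rintro ⟨w, hw⟩
    suffices h : diff ε n w ∈ (Submodule.pi Set.univ fun j : Fin (n + 1) =>
        coboundaries (X := X) (n + j) j).map (S.totalMap n) by
      obtain ⟨c', hc', h'⟩ := h
      rw [hw] at h'
      rw [← (S.totalMap_bijective hn).1 h']
      exact fun j => hc' j trivial
    rw [← Submodule.mem_comap]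
    refine Submodule.span_le.2 ?_ (S.mem_span_coxeterMap (n + 1) w)
    rintro _ ⟨k, b, -, rfl⟩
    rw [SetLike.mem_coe, Submodule.mem_comap]
    obtain ⟨N, hN⟩ : ∃ N, n + 1 + k = N := ⟨_, rfl⟩
    revert b
    rw [hN]
    intro b
    rw [S.diff_coxeterMap hN.symm]
    obtain rfl : N = n + (k + 1) := by omega
    -- In `S_{n+k+1}`, a set of `k + 1` commuting generators needs `2k + 2` letters, so there is
    -- none for `k ≥ n`, and the image of `b` is zero.
    by_cases hk : n < k + 1
    · have := isEmpty_commutingSet (N := n + (k + 1)) rfl hk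
      rw [Subsingleton.elim (d _ _ k b) 0, map_zero]
      exact Submodule.zero_mem _
    · let j : Fin (n + 1) := ⟨k + 1, by omega⟩
      refine ⟨Pi.single j (d (simpleTransposition_mul_self _) _ k b), fun i _ => ?_,
        S.totalMap_single n j _⟩
      by_cases h : i = j
      · subst h
        rw [Pi.single_eq_same]
        exact ⟨b, rfl⟩
      · rw [Pi.single_eq_of_ne h]
        exact Submodule.zero_mem _
  · intro h
    rw [totalMap_apply]
    refine Submodule.sum_mem _ fun j _ => ?_
    have hj := h j
    generalize c j = b at hj
    obtain ⟨k, hk⟩ := j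
    cases k with
    | zero =>
      obtain rfl : b = 0 := hj
      rw [map_zero]
      exact Submodule.zero_mem _
    | succ k =>
      obtain ⟨b, rfl⟩ := hj
      exact ⟨_, S.diff_coxeterMap (by simp; omega) b⟩

lemma map_totalMap {σ : R ≃ₐ[ℂ] R} (h : ∀ r, ε (σ r) = ε r) {H : Type*} [Group H]
    (π : Representation ℂ H (X → ℂ)) (g : H)
    (hg : ∀ v, idealMap h (S.ι v) = S.ι (π g v)) (n : ℕ)
    (c : ∀ j : Fin (n + 1), Cochain (simpleTransposition (n + j)) (permRep (X → ℂ) (n + j)) j) :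
    Bar.map h n (S.totalMap n c) = S.totalMap n (fun j => cochainMap _ _ (powerRep π (n + j) g)
      (fun τ => commute_permRep_powerRep π (n + j) τ g) j (c j)) := by
  rw [totalMap_apply, totalMap_apply, map_sum]
  exact Finset.sum_congr rfl fun j _ => S.map_coxeterMap h π g hg rfl (c j)

/-- Over an algebra `ℂ ⊕ V ⊕ Sym² V`, the representation on `Tor_i` for `i ≥ 1` of a group acting
through its representation on `V` is the sum of those on the Coxeter cohomology of tensor powers
of `V`. -/
theorem nonempty_torRep_equiv [Fintype X] [DecidableEq X] {H : Type*} [Group H]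
    (φ : H →* (R ≃ₐ[ℂ] R)) (h : ∀ g r, ε (φ g r) = ε r) (π : Representation ℂ H (X → ℂ))
    (hπ : ∀ g v, idealMap (h g) (S.ι v) = S.ι (π g v)) {i : ℕ} (hi : 1 ≤ i) :
    Nonempty ((torRep ε φ h i).Equiv (Representation.directSum fun j : Fin (i + 1) =>
      coxeterCohomologyRep π (i + j) j)) := by
  let C := tensorComplex ε (resolution ε)
  let D : ∀ j : Fin (i + 1), CochainComplex (ModuleCat ℂ) ℕ := fun j =>
    cochainComplex (simpleTransposition_mul_self (i + j)) (permRep (X → ℂ) (i + j))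
  let J : barSpace ε i ≃ₗ[ℂ] C.X i := LinearEquiv.ofBijective (toTensor ε i) (toTensor_bijective i)
  let Φ : (∀ j : Fin (i + 1), ((D j).sc j).X₂) ≃ₗ[ℂ] (C.sc i).X₂ :=
    (LinearEquiv.ofBijective (S.totalMap i) (S.totalMap_bijective hi)).trans J
  have hΦ : ∀ c, Φ c = toTensor ε i (S.totalMap i c) := fun c => rfl
  have hker : ∀ c, (C.sc i).g.hom (Φ c) = 0 ↔ ∀ j, ((D j).sc j).g.hom (c j) = 0 := by
    intro c
    obtain ⟨n, rfl⟩ : ∃ n, i = n + 1 := ⟨i - 1, by omega⟩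
    refine (HomologicalComplex.sc_g_apply_eq_zero_iff C (ChainComplex.next_nat_succ n)
      (Φ c)).trans ?_
    rw [hΦ, tensorComplex_d_toTensor, map_eq_zero_iff _ (toTensor_bijective n).1]
    refine (S.diff_totalMap_eq_zero_iff n c).trans (forall_congr' fun j => ?_)
    refine Iff.trans ?_ (HomologicalComplex.sc_g_apply_eq_zero_iff (D j)
      (CochainComplex.next ℕ j) (c j)).symm
    rw [cochainComplex_d]
    rfl
  have hran : ∀ c, Φ c ∈ LinearMap.range (C.sc i).f.hom ↔
      ∀ j, c j ∈ LinearMap.range ((D j).sc j).f.hom := by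
    intro c
    refine (HomologicalComplex.mem_range_sc_f_iff C (ChainComplex.prev ℕ i) (Φ c)).trans ?_
    rw [hΦ]
    have h1 : (∃ y, (C.d (i + 1) i).hom y = toTensor ε i (S.totalMap i c)) ↔
        S.totalMap i c ∈ LinearMap.range (diff ε i) := by
      constructor
      · rintro ⟨y, hy⟩
        obtain ⟨w, rfl⟩ := (toTensor_bijective (i + 1)).2 y
        rw [tensorComplex_d_toTensor] at hy
        exact ⟨w, (toTensor_bijective i).1 hy⟩
      · rintro ⟨w, hw⟩
        exact ⟨toTensor ε (i + 1) w, by rw [tensorComplex_d_toTensor, hw]⟩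
    refine h1.trans ((S.totalMap_mem_range_diff_iff hi c).trans (forall_congr' fun ⟨j, hj⟩ => ?_))
    cases j with
    | zero =>
      refine Iff.trans ?_ (HomologicalComplex.mem_range_sc_f_iff (D ⟨0, hj⟩)
        CochainComplex.prev_nat_zero (c ⟨0, hj⟩)).symm
      rw [HomologicalComplex.shape _ _ _ (by simp)]
      constructor
      · intro h
        exact ⟨0, Eq.symm h⟩
      · rintro ⟨_, h⟩
        exact Eq.symm h
    | succ j =>
      refine Iff.trans ?_ (HomologicalComplex.mem_range_sc_f_iff (D ⟨j + 1, hj⟩)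
        (CochainComplex.prev_nat_succ j) (c ⟨j + 1, hj⟩)).symm
      rw [cochainComplex_d]
      rfl
  obtain ⟨e, he⟩ := ShortComplex.exists_homologyEquiv (C.sc i) (fun j => (D j).sc j) Φ hker hran
  refine ⟨Representation.Equiv.mk ((torIso ε (resolution ε) i).toLinearEquiv ≪≫ₗ e) fun g => ?_⟩
  refine LinearMap.ext fun x => ?_
  have h1 : (torIso ε (resolution ε) i).hom.hom ((torEnd ε (φ g) (h g) i).hom x) = _ :=
    ConcreteCategory.congr_hom (torEnd_eq ε _ (φ g) (h g) (resolutionLift (h g)) i) x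
  refine (congrArg e h1).trans ?_
  refine he ((HomologicalComplex.shortComplexFunctor _ _ i).map ((resolutionLift (h g)).chainMap
    (h g))) (fun j => (HomologicalComplex.shortComplexFunctor _ _ (j : ℕ)).map
      (complexMap (simpleTransposition_mul_self (i + j)) (permRep (X → ℂ) (i + j))
      (powerRep π (i + j) g) (fun τ => commute_permRep_powerRep π (i + j) τ g))) ?_ _
  intro c
  refine (chainMap_toTensor (h g) i _).trans ?_
  exact congrArg (toTensor ε i) (S.map_totalMap (h g) π g (hπ g) i c)

end AugTor.CubeZero

end

theorem mainTheorem3 (m i : ℕ) (hi : 1 ≤ i) :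
    Nonempty
      ((AugTor.torRep (FatPoint.augmentation m) (FatPoint.glAction m)
          (FatPoint.augmentation_glAction m) i).Equiv
        (Representation.directSum fun j : Fin (i + 1) =>
          TypeA.coxeterCohomologyRep (FatPoint.standardRep m) (i + j) j)) := by
  exact (FatPoint.cubeZero m).nonempty_torRep_equiv _ _ _ FatPoint.idealMap_linearFormIdeal hi
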